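/- Let $d,m\ge 0$ be integers, $T>0$, $1\le p,q\le\infty$, $1/q+1/q'=1$, and let $|\cdot|$ be the Euclidean norm. Let $W^d_{1,p}(0,T)$ be the space of absolutely continuous $x:[0,T]\to\mathbb R^d$ with $\dot x\in L^p$, with norm $\|x\|_{1,p}=\|x\|_p+\|\dot x\|_p$, and let $X=W^d_{1,p}(0,T)\times L^m_q(0,T)$ with norm $\|(x,u)\|_X=\|x\|_{1,p}+\|u\|_q$. Let $\theta:\mathbb R^d\times\mathbb R^m\times[0,T]\to\mathbb R$ and $f:\mathbb R^d\times\mathbb R^m\times[0,T]\to\mathbb R^d$ be given functions, $x_0,x_T\in\mathbb R^d$, and let $U\subseteq L^m_q(0,T)$ be nonempty and closed. Consider the fixed-endpoint problem $$\min\ \mathcal I(x,u)=\int_0^T\theta(x(t),u(t),t)\,dt\quad\text{subject to}\quad (x,u)\in\Omega=\{(x,u)\in A : x(T)=x_T\},\qquad(\mathcal P)$$ where $A=\{(x,u)\in X : x(0)=x_0,\ u\in U,\ \dot x(t)=f(x(t),u(t),t)\text{ for a.e. }t\in[0,T]\}$. Denote by $\mathcal I^*$ the optimal value of $(\mathcal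 P)$, and set $\varphi(x,u)=|x(T)-x_T|$, $\Phi_\lambda=\mathcal I+\lambda\varphi$, $S_\lambda(c)=\{(x,u)\in A:\Phi_\lambda(x,u)<c\}$, $\Omega_\delta=\{(x,u)\in A:\varphi(x,u)<\delta\}$, and $\mathcal R(x_0,T)=\{x(T):(x,u)\in A\}$. Definitions. - A function $g(x,u,t)$ satisfies the growth condition of order $(l,s)$ if for every $R>0$ there are $C_R>0$ and an a.e. nonnegative $\omega_R\in L^s(0,T)$ such that $|g(x,u,t)|\le C_R|u|^l+\omega_R(t)$ for a.e. $t\in[0,T]$ and all $u\in\mathbb R^m$, $x\in\mathbb R^d$ with $|x|\le R$. - $\mathcal R(x_0,T)$ has the negative tangent angle property near $x_T$ if there are a neighbourhood $\mathcal O$ of $x_T$ and $\beta>0$ such that for every $\xi\in\mathcal O\cap\mathcal R(x_0,T)$ with $\xi\ne x_T$ there is a sequence $\xi_n\in\mathcal R(x_0,T)\setminus\{\xi\}$ with $\xi_n\to\xi$ and $\Big\langle\frac{\xi-x_T}{|\xi-x_T|},\frac{\xi_n-\xi}{|\xi_n-\xi|}\Big\rangle\le-\beta$ for all $n$. - Property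 $(\mathcal S)$ holds on $K\subseteq A$ if there is $C>0$ such that every $(x,u)\in K$ admits a neighbourhood $\mathcal O(x(T))\subset\mathbb R^d$ of $x(T)$ such that for every $\widehat x_T\in\mathcal O(x(T))\cap\mathcal R(x_0,T)$ there is $(\widehat x,\widehat u)\in A$ with $\widehat x(T)=\widehat x_T$ and $\|u-\widehat u\|_q+\|x-\widehat x\|_{1,p}\le C|x(T)-\widehat x(T)|$. - For $F:X\to\mathbb R$, $K\subseteq X$, $z\in K$, let $F^{\downarrow}_K(z)=\liminf_{y\to z,\ y\in K,\ y\neq z}\frac{F(y)-F(z)}{\|y-z\|_X}\in[-\infty,+\infty]$, which is $+\infty$ if $z$ is an isolated point of $K$. The point $z\in K$ is inf-stationary for $F$ on $K$ if $F^{\downarrow}_K(z)\ge0$. - $\Phi_\lambda$ is completely exact on $S_\lambda(c)$ if (1) $\inf_A\Phi_\lambda=\inf_\Omega\mathcal I$; (2) the globally optimal solutions of $(\mathcal P)$ and of the penalised problem $\min_A\Phi_\lambda$ coincide; (3) a point $z\in S_\lambda(c)$ is a locally optimal solution of the penalised problem iff $z\in\Omega$ and $z$ is a locally optimal solution of $(\mathcal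 P)$; (4) a point $z\in S_\lambda(c)$ is inf-stationary for $\Phi_\lambda$ on $A$ iff $z\in\Omega$ and $z$ is inf-stationary for $\mathcal I$ on $\Omega$. Theorem. Suppose that 1. $\theta$ is continuous and differentiable in $x$ and in $u$, and $\nabla_x\theta$, $\nabla_u\theta$ and $f$ are continuous on $\mathbb R^d\times\mathbb R^m\times[0,T]$; 2. either $q=\infty$, or $\theta$ and $\nabla_x\theta$ satisfy the growth condition of order $(q,1)$ and $\nabla_u\theta$ satisfies the growth condition of order $(q-1,q')$; 3. $(\mathcal P)$ has a globally optimal solution; 4. $\mathcal R(x_0,T)$ has the negative tangent angle property near $x_T$; 5. $\lambda_0>0$, $c\in\mathbb R$ with $c>\mathcal I^*$, and $\delta>0$ are such that $S_{\lambda_0}(c)\cap\Omega_\delta$ is bounded in $X$, property $(\mathcal S)$ holds on $S_{\lambda_0}(c)\cap(\Omega_\delta\setminus\Omega)$, and $\Phi_{\lambda_0}$ is bounded below on $A$. Then there exists $\lambda^*\ge0$ such that for every $\lambda\ge\lambda^*$ the penalty function $\Phi_\lambda$ is completely exact on $S_\lambda(c)$. -/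

import Mathlib

open MeasureTheory Filter Topology Set
open scoped ENNReal

noncomputable section

namespace ExactPenalty

/-! ### Optimisation on a metric space -/

section Abstract

variable {Z : Type*} [MetricSpace Z]

/-- The rate of steepest descent of `F` with respect to `K` at `x`: the lower limit of
`(F y - F x) / d(y, x)` as `y → x`, `y ∈ K`, `y ≠ x`. It is an extended real number, and it equals
`⊤` when `x` is an isolated point of `K` (see `rateOfSteepestDescent_of_isolated`). -/
def rateOfSteepestDescent (F : Z → ℝ) (K : Set Z) (x : Z) : EReal :=
  liminf (fun y => (((F y - F x) / dist y x : ℝ) : EReal)) (𝓝[K \ {x}] x)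

theorem rateOfSteepestDescent_of_isolated (F : Z → ℝ) (K : Set Z) (x : Z)
    (h : 𝓝[K \ {x}] x = ⊥) : rateOfSteepestDescent F K x = ⊤ := by
  simp [rateOfSteepestDescent, h]

/-- `x` is an inf-stationary point of `F` on `K`. -/
def IsInfStationary (F : Z → ℝ) (K : Set Z) (x : Z) : Prop :=
  x ∈ K ∧ 0 ≤ rateOfSteepestDescent F K x

/-- `x` is a globally optimal solution of the problem of minimising `F` over `K`. -/
def IsGlobalSolution (F : Z → ℝ) (K : Set Z) (x : Z) : Prop :=
  x ∈ K ∧ ∀ y ∈ K, F x ≤ F y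

/-- `x` is a locally optimal solution of the problem of minimising `F` over `K`. -/
def IsLocalSolution (F : Z → ℝ) (K : Set Z) (x : Z) : Prop :=
  x ∈ K ∧ IsLocalMinOn F K x

/-- The optimal value (infimum) of the problem of minimising `F` over `K`, as an extended real. -/
def optimalValue (F : Z → ℝ) (K : Set Z) : EReal :=
  ⨅ z ∈ K, (F z : EReal)

/-- The four properties that make up the complete exactness, on the set `S`, of a penalty function
`Φ` for the problem of minimising `J` over `Ω`, the penalised problem being that of minimising `Φ`
over `A`. -/
structure IsCompletelyExactOn (J Φ : Z → ℝ) (Ω A S : Set Z) : Prop where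
  optimalValue_eq : optimalValue Φ A = optimalValue J Ω
  globalSolution_iff : ∀ z, IsGlobalSolution Φ A z ↔ IsGlobalSolution J Ω z
  localSolution_iff : ∀ z ∈ S, IsLocalSolution Φ A z ↔ z ∈ Ω ∧ IsLocalSolution J Ω z
  infStationary_iff : ∀ z ∈ S, IsInfStationary Φ A z ↔ z ∈ Ω ∧ IsInfStationary J Ω z

end Abstract

/-! ### Function spaces on `[0, T]` -/

/-- `ℝⁿ` with the Euclidean norm. -/
abbrev Vec (n : ℕ) : Type := EuclideanSpace ℝ (Fin n)

/-- Lebesgue measure on `[0, T]`. -/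
abbrev timeMeasure (T : ℝ) : Measure ℝ := volume.restrict (Icc 0 T)

/-- The space `L_q^m(0, T)` of controls, with the usual norm. -/
abbrev ControlSpace (m : ℕ) (q : ℝ≥0∞) (T : ℝ) : Type := Lp (Vec m) q (timeMeasure T)

theorem ae_differentiableAt_of_ac {d : ℕ} {T : ℝ} {x : ℝ → Vec d}
    (hx : AbsolutelyContinuousOnInterval x 0 T) :
    ∀ᵐ t, t ∈ uIcc 0 T → DifferentiableAt ℝ x t :=
  hx.boundedVariationOn.ae_differentiableAt_of_mem_uIcc

theorem deriv_add_ae {d : ℕ} {T : ℝ} {x y : ℝ → Vec d}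
    (hx : AbsolutelyContinuousOnInterval x 0 T) (hy : AbsolutelyContinuousOnInterval y 0 T) :
    deriv (x + y) =ᵐ[timeMeasure T] deriv x + deriv y := by
  refine (ae_restrict_iff' measurableSet_Icc).2 ?_
  filter_upwards [ae_differentiableAt_of_ac hx, ae_differentiableAt_of_ac hy] with t h1 h2 ht
  have ht' := Icc_subset_uIcc ht
  exact deriv_add (h1 ht') (h2 ht')

/-- The functions `[0, T] → ℝᵈ` that are absolutely continuous and whose (almost everywhere defined)
derivative belongs to `Lᵖ`. A function on `[0, T]` is represented by the function on `ℝ` that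
extends it by the constants `x 0` on the left and `x T` on the right, so that two elements are equal
iff they agree on `[0, T]`. -/
def sobolevAddSubgroup (d : ℕ) (p : ℝ≥0∞) (T : ℝ) : AddSubgroup (ℝ → Vec d) where
  carrier := {x | AbsolutelyContinuousOnInterval x 0 T ∧ MemLp (deriv x) p (timeMeasure T) ∧
    ∀ t, x t = x (max 0 (min T t))}
  add_mem' := by
    rintro x y ⟨hx, hx', hx''⟩ ⟨hy, hy', hy''⟩
    refine ⟨hx.add hy, (hx'.add hy').ae_eq (deriv_add_ae hx hy).symm, fun t => ?_⟩
    simp only [Pi.add_apply]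
    rw [hx'' t, hy'' t]
  zero_mem' := by
    refine ⟨?_, ?_, fun t => rfl⟩
    · exact (LipschitzWith.const (0 : Vec d)).lipschitzOnWith.absolutelyContinuousOnInterval
    · have h : deriv (0 : ℝ → Vec d) = 0 := by
        ext1 t; exact deriv_const t (0 : Vec d)
      rw [h]; exact MemLp.zero
  neg_mem' := by
    rintro x ⟨hx, hx', hx''⟩
    refine ⟨hx.neg, ?_, fun t => ?_⟩
    · have h : deriv (-x) = -deriv x := by
        ext1 t; exact deriv.neg
      rw [h]; exact hx'.neg
    · simp only [Pi.neg_apply]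
      rw [hx'' t]

/-- The Sobolev space `W_{1,p}^d(0, T)`. -/
def SobolevSpace (d : ℕ) (p : ℝ≥0∞) (T : ℝ) : Type := sobolevAddSubgroup d p T

namespace SobolevSpace

variable {d : ℕ} {p : ℝ≥0∞} {T : ℝ}

instance : AddCommGroup (SobolevSpace d p T) :=
  inferInstanceAs (AddCommGroup (sobolevAddSubgroup d p T))

instance : CoeFun (SobolevSpace d p T) (fun _ => ℝ → Vec d) := ⟨fun x => x.1⟩

theorem ac (x : SobolevSpace d p T) : AbsolutelyContinuousOnInterval x 0 T := x.2.1

theorem memLp_deriv (x : SobolevSpace d p T) : MemLp (deriv x) p (timeMeasure T) := x.2.2.1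

theorem apply_eq (x : SobolevSpace d p T) (t : ℝ) : x t = x (max 0 (min T t)) := x.2.2.2 t

theorem coe_add (x y : SobolevSpace d p T) : ((x + y : SobolevSpace d p T) : ℝ → Vec d) = x + y :=
  rfl

theorem coe_neg (x : SobolevSpace d p T) : ((-x : SobolevSpace d p T) : ℝ → Vec d) = -x := rfl

theorem coe_zero : ((0 : SobolevSpace d p T) : ℝ → Vec d) = 0 := rfl

theorem continuousOn (x : SobolevSpace d p T) : ContinuousOn x (Icc 0 T) :=
  x.ac.continuousOn.mono Icc_subset_uIcc

theorem memLp (x : SobolevSpace d p T) : MemLp x p (timeMeasure T) := by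
  obtain ⟨C, hC⟩ := isCompact_Icc.exists_bound_of_continuousOn x.continuousOn
  refine MemLp.of_bound (x.continuousOn.aestronglyMeasurable measurableSet_Icc) C ?_
  exact (ae_restrict_iff' measurableSet_Icc).2 (Eventually.of_forall hC)

theorem ext_of_eqOn (hT : 0 ≤ T) {x y : SobolevSpace d p T} (h : EqOn x y (Icc 0 T)) : x = y := by
  refine Subtype.ext (funext fun t => ?_)
  rw [x.apply_eq, y.apply_eq]
  exact h ⟨le_max_left _ _, max_le hT (min_le_left _ _)⟩

/-- The norm `‖x‖_{1,p} = ‖x‖_p + ‖ẋ‖_p`. -/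
def sobolevNorm [Fact (1 ≤ p)] [Fact (0 < T)] : AddGroupNorm (SobolevSpace d p T) where
  toFun x := (eLpNorm x p (timeMeasure T)).toReal + (eLpNorm (deriv x) p (timeMeasure T)).toReal
  map_zero' := by
    have h : deriv (0 : ℝ → Vec d) = 0 := by
      ext1 t; exact deriv_const t (0 : Vec d)
    rw [coe_zero, h]; simp
  add_le' x y := by
    have hp : 1 ≤ p := Fact.out
    have h1 := ENNReal.toReal_mono (ENNReal.add_ne_top.2 ⟨x.memLp.2.ne, y.memLp.2.ne⟩)
      (eLpNorm_add_le x.memLp.1 y.memLp.1 hp)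
    have h2 := ENNReal.toReal_mono
      (ENNReal.add_ne_top.2 ⟨x.memLp_deriv.2.ne, y.memLp_deriv.2.ne⟩)
      (eLpNorm_add_le x.memLp_deriv.1 y.memLp_deriv.1 hp)
    rw [ENNReal.toReal_add x.memLp.2.ne y.memLp.2.ne] at h1
    rw [ENNReal.toReal_add x.memLp_deriv.2.ne y.memLp_deriv.2.ne,
      ← eLpNorm_congr_ae (deriv_add_ae x.ac y.ac)] at h2
    rw [coe_add]
    linarith
  neg' x := by
    have h : deriv (-(x : ℝ → Vec d)) = -deriv x := by
      ext1 t; exact deriv.neg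
    rw [coe_neg, h, eLpNorm_neg, eLpNorm_neg]
  eq_zero_of_map_eq_zero' x hx := by
    have hp : 1 ≤ p := Fact.out
    have hT : 0 < T := Fact.out
    have h0 : (eLpNorm x p (timeMeasure T)).toReal = 0 :=
      ((add_eq_zero_iff_of_nonneg ENNReal.toReal_nonneg ENNReal.toReal_nonneg).1 hx).1
    have h1 : eLpNorm x p (timeMeasure T) = 0 :=
      ((ENNReal.toReal_eq_zero_iff _).1 h0).resolve_right x.memLp.2.ne
    rw [eLpNorm_eq_zero_iff x.memLp.1 (zero_lt_one.trans_le hp).ne'] at h1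
    exact ext_of_eqOn hT.le
      (Measure.eqOn_Icc_of_ae_eq volume hT.ne h1 x.continuousOn continuousOn_const)

instance [Fact (1 ≤ p)] [Fact (0 < T)] : NormedAddCommGroup (SobolevSpace d p T) :=
  sobolevNorm.toNormedAddCommGroup

theorem norm_def [Fact (1 ≤ p)] [Fact (0 < T)] (x : SobolevSpace d p T) :
    ‖x‖ = (eLpNorm x p (timeMeasure T)).toReal + (eLpNorm (deriv x) p (timeMeasure T)).toReal :=
  rfl

end SobolevSpace

/-- The space `X = W_{1,p}^d(0, T) × L_q^m(0, T)` with the norm `‖(x, u)‖ = ‖x‖_{1,p} + ‖u‖_q`. -/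
abbrev PairSpace (d m : ℕ) (p q : ℝ≥0∞) (T : ℝ) : Type :=
  WithLp 1 (SobolevSpace d p T × ControlSpace m q T)

/-- The growth condition of order `(l, s)` for a function `g(x, u, t)`, `t ∈ [0, T]`. -/
def GrowthCondition {d m : ℕ} {F : Type*} [NormedAddCommGroup F] (T : ℝ)
    (g : Vec d → Vec m → ℝ → F) (l : ℝ) (s : ℝ≥0∞) : Prop :=
  ∀ R : ℝ, 0 < R → ∃ C : ℝ, 0 < C ∧ ∃ ω : ℝ → ℝ, MemLp ω s (timeMeasure T) ∧
    (∀ᵐ t ∂(timeMeasure T), 0 ≤ ω t) ∧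
    ∀ᵐ t ∂(timeMeasure T), ∀ (x : Vec d) (u : Vec m), ‖x‖ ≤ R → ‖g x u t‖ ≤ C * ‖u‖ ^ l + ω t

/-- A function of `(x, u, t)` is continuous on `ℝᵈ × ℝᵐ × [0, T]`. -/
def ContinuousOnTime {d m : ℕ} {F : Type*} [TopologicalSpace F] (T : ℝ)
    (g : Vec d → Vec m → ℝ → F) : Prop :=
  ContinuousOn (fun w : Vec d × Vec m × ℝ => g w.1 w.2.1 w.2.2) {w | w.2.2 ∈ Icc 0 T}

/-- The gradient of `x ↦ θ(x, u, t)`. -/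
def gradX {d m : ℕ} (θ : Vec d → Vec m → ℝ → ℝ) (x : Vec d) (u : Vec m) (t : ℝ) : Vec d :=
  gradient (fun y => θ y u t) x

/-- The gradient of `u ↦ θ(x, u, t)`. -/
def gradU {d m : ℕ} (θ : Vec d → Vec m → ℝ → ℝ) (x : Vec d) (u : Vec m) (t : ℝ) : Vec m :=
  gradient (fun v => θ x v t) u

/-! ### The fixed-endpoint optimal control problem -/

/-- The data of the problem of minimising `∫₀ᵀ θ(x(t), u(t), t) dt` subject to
`ẋ(t) = f(x(t), u(t), t)`, `x(0) = x₀`, `x(T) = x_T`, `u ∈ U`. Only the values of `θ` and `f` at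
times in `[0, T]` matter. -/
structure ControlProblem (d m : ℕ) (q : ℝ≥0∞) (T : ℝ) where
  /-- the running cost -/
  θ : Vec d → Vec m → ℝ → ℝ
  /-- the right-hand side of the differential equation -/
  f : Vec d → Vec m → ℝ → Vec d
  /-- the initial state -/
  x₀ : Vec d
  /-- the prescribed final state -/
  x_T : Vec d
  /-- the set of admissible controls -/
  U : Set (ControlSpace m q T)

namespace ControlProblem

variable {d m : ℕ} {p q : ℝ≥0∞} {T : ℝ}

/-- The cost functional. -/
def cost (P : ControlProblem d m q T) (z : PairSpace d m p q T) : ℝ :=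
  ∫ t, P.θ (z.fst t) (z.snd t) t ∂(timeMeasure T)

/-- The penalty term `φ(x, u) = |x(T) - x_T|`. -/
def penaltyTerm (P : ControlProblem d m q T) (z : PairSpace d m p q T) : ℝ :=
  ‖z.fst T - P.x_T‖

/-- The penalty function `Φ_lam = cost + lam * φ`. -/
def penaltyFn (P : ControlProblem d m q T) (lam : ℝ) (z : PairSpace d m p q T) : ℝ :=
  P.cost z + lam * P.penaltyTerm z

/-- The set `A` of admissible pairs of the free-endpoint problem. -/
def admissible (P : ControlProblem d m q T) (p : ℝ≥0∞) : Set (PairSpace d m p q T) :=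
  {z | z.fst 0 = P.x₀ ∧ z.snd ∈ P.U ∧
    ∀ᵐ t ∂(timeMeasure T), deriv z.fst t = P.f (z.fst t) (z.snd t) t}

/-- The feasible set `Ω = M ∩ A` of the fixed-endpoint problem. -/
def feasible (P : ControlProblem d m q T) (p : ℝ≥0∞) : Set (PairSpace d m p q T) :=
  {z | z.fst T = P.x_T} ∩ P.admissible p

/-- The sublevel set `S_lam(c)`. -/
def sublevel (P : ControlProblem d m q T) (p : ℝ≥0∞) (lam c : ℝ) : Set (PairSpace d m p q T) :=
  {z | z ∈ P.admissible p ∧ P.penaltyFn lam z < c}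

/-- The set `Ω_δ`. -/
def nearFeasible (P : ControlProblem d m q T) (p : ℝ≥0∞) (δ : ℝ) : Set (PairSpace d m p q T) :=
  {z | z ∈ P.admissible p ∧ P.penaltyTerm z < δ}

/-- The set `R(x₀, T)` that is reachable in time `T`. -/
def reachable (P : ControlProblem d m q T) (p : ℝ≥0∞) : Set (Vec d) :=
  {ξ | ∃ z ∈ P.admissible p, ξ = z.fst T}

/-- The property `(S)` on a set `K` of admissible pairs. -/
def SensitivityProperty [Fact (1 ≤ p)] [Fact (1 ≤ q)] [Fact (0 < T)]
    (P : ControlProblem d m q T) (K : Set (PairSpace d m p q T)) : Prop :=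
  ∃ C : ℝ, 0 < C ∧ ∀ z ∈ K, ∃ O ∈ 𝓝 (z.fst T), ∀ ξ ∈ O ∩ P.reachable p,
    ∃ w ∈ P.admissible p, w.fst T = ξ ∧
      ‖z.snd - w.snd‖ + ‖z.fst - w.fst‖ ≤ C * ‖z.fst T - w.fst T‖

end ControlProblem

/-- The set `R` has the negative tangent angle property near `y`. -/
def NegativeTangentAngleProperty {d : ℕ} (R : Set (Vec d)) (y : Vec d) : Prop :=
  ∃ O ∈ 𝓝 y, ∃ β : ℝ, 0 < β ∧ ∀ ξ ∈ O ∩ R, ξ ≠ y →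
    ∃ ξs : ℕ → Vec d, (∀ n, ξs n ∈ R ∧ ξs n ≠ ξ) ∧ Tendsto ξs atTop (𝓝 ξ) ∧
      ∀ n, inner ℝ (‖ξ - y‖⁻¹ • (ξ - y)) (‖ξs n - ξ‖⁻¹ • (ξs n - ξ)) ≤ -β

end ExactPenalty

end

/-! Exactness rests on two uniform estimates near the points of a truncated sublevel set of the
penalty function: the cost is Lipschitz there with one constant `L`, and at infeasible points the
penalty term `φ` can be decreased at a rate at least `a > 0`. Once `lam * a ≥ L + 1`, the penalty
function has descent rate at least 1 at every infeasible point of its sublevel set, so such a point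
is neither a local minimiser nor inf-stationary. Ekeland's principle on the complete set `A` turns
the infinitesimal descent into global statements: no value lies below the optimal value, and near a
feasible point each admissible `w` has a feasible `y` with `J y + dist w y ≤ J w + lam * φ w`, which
carries optimality and stationarity from `Ω` to `A` (`exists_isCompletelyExactOn`).

For the control problem, `A` is complete because the Sobolev space is complete and `A` is closed
(`isClosed_admissible`). The Lipschitz bound comes from the growth conditions and Hölder's
inequality (`exists_abs_cost_sub_le`). The descent of `|x(T) - x_T|` comes from the angle property,
which moves the endpoint towards `x_T` within the reachable set, and property (S), which realises
that move at proportional cost in `X` (`exists_penaltyTerm_descent`). -/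

noncomputable section

namespace ExactPenalty

/-! ### Ekeland's principle and exact penalisation in metric spaces -/

section Abstract

variable {Z : Type*} [MetricSpace Z]

/-- Ekeland's variational principle for a continuous function on a complete set. -/
theorem exists_ekeland {G : Z → ℝ} {K : Set Z} (hK : IsComplete K) (hG : ContinuousOn G K)
    (hb : BddBelow (G '' K)) {ε : ℝ} (hε : 0 < ε) {z : Z} (hz : z ∈ K) :
    ∃ y ∈ K, G y + ε * dist z y ≤ G z ∧ ∀ v ∈ K, G v + ε * dist y v ≤ G y → v = y := by
  -- Each step moves to a minimiser, up to `1 / (n + 1)`, of `G` over the points that dominate `x`.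
  have step : ∀ (n : ℕ) (x : K), ∃ y : K, G y + ε * dist (x : Z) y ≤ G x ∧
      ∀ v ∈ K, G v + ε * dist (x : Z) v ≤ G x → G y ≤ G v + 1 / ((n : ℝ) + 1) := by
    intro n x
    let S : Set ℝ := G '' {v ∈ K | G v + ε * dist (x : Z) v ≤ G x}
    have hS : S.Nonempty := ⟨_, x, ⟨x.2, by simp⟩, rfl⟩
    have hSb : BddBelow S := hb.mono (image_mono fun v hv => hv.1)
    have hn : (0 : ℝ) < 1 / ((n : ℝ) + 1) := by positivity
    obtain ⟨_, ⟨y, hy, rfl⟩, hlt⟩ := exists_lt_of_csInf_lt hS (lt_add_of_pos_right (sInf S) hn)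
    refine ⟨⟨y, hy.1⟩, hy.2, fun v hv hvx => ?_⟩
    have := csInf_le hSb ⟨v, ⟨hv, hvx⟩, rfl⟩
    linarith
  choose g hg1 hg2 using step
  let s : ℕ → K := fun n => Nat.rec ⟨z, hz⟩ (fun k x => g k x) n
  have hs : ∀ n, s (n + 1) = g n (s n) := fun n => rfl
  have hdist : ∀ n k : ℕ, G (s (n + k)).1 + ε * dist (s n).1 (s (n + k)).1 ≤ G (s n).1 := by
    intro n k
    induction k with
    | zero => simp
    | succ k ih =>
      have h1 := hg1 (n + k) (s (n + k))
      have h2 := dist_triangle (s n).1 (s (n + k)).1 (s (n + k + 1)).1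
      rw [← add_assoc]
      nlinarith
  have hanti : Antitone fun n => G (s n).1 := by
    refine antitone_nat_of_succ_le fun n => ?_
    have := hdist n 1
    have : 0 ≤ ε * dist (s n).1 (s (n + 1)).1 := by positivity
    linarith
  have hbs : BddBelow (range fun n => G (s n).1) :=
    hb.mono (range_subset_iff.2 fun n => mem_image_of_mem G (s n).2)
  have hlim := tendsto_atTop_ciInf hanti hbs
  set ℓ := ⨅ n, G (s n).1
  have hcs : CauchySeq fun n => (s n).1 := by
    refine cauchySeq_of_le_tendsto_0' (fun n => (G (s n).1 - ℓ) / ε) (fun n k hnk => ?_) ?_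
    · obtain ⟨j, rfl⟩ := Nat.exists_eq_add_of_le hnk
      rw [le_div_iff₀ hε]
      have h1 := hdist n j
      have h2 : ℓ ≤ G (s (n + j)).1 := ciInf_le hbs _
      linarith
    · have := (hlim.sub_const ℓ).div_const ε
      simpa using this
  obtain ⟨y, hyK, hy⟩ := cauchySeq_tendsto_of_isComplete hK (fun n => (s n).2) hcs
  have hGy : Tendsto (fun n => G (s n).1) atTop (𝓝 (G y)) :=
    (hG y hyK).tendsto.comp (tendsto_nhdsWithin_iff.2 ⟨hy, Eventually.of_forall fun n => (s n).2⟩)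
  have hy_le : ∀ n : ℕ, G y + ε * dist (s n).1 y ≤ G (s n).1 := by
    intro n
    have h1 : Tendsto (fun k => G (s (n + k)).1 + ε * dist (s n).1 (s (n + k)).1) atTop
        (𝓝 (G y + ε * dist (s n).1 y)) := by
      have hsh : Tendsto (fun k => n + k) atTop atTop := tendsto_add_atTop_nat n |>.congr
        fun k => add_comm _ _
      exact (hGy.comp hsh).add ((tendsto_const_nhds.dist (hy.comp hsh)).const_mul ε)
    exact le_of_tendsto h1 (Eventually.of_forall (hdist n))
  refine ⟨y, hyK, hy_le 0, fun v hv hvy => ?_⟩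
  -- By the triangle inequality, a point that dominates the limit `y` dominates every iterate, so it
  -- competed in every near-minimisation.
  have hle : ∀ n : ℕ, G (s (n + 1)).1 ≤ G v + 1 / ((n : ℝ) + 1) := by
    intro n
    rw [hs]
    refine hg2 n (s n) v hv ?_
    have h1 := hy_le n
    have h2 := dist_triangle (s n).1 y v
    nlinarith
  have hGv : G y ≤ G v := by
    have h1 := (tendsto_const_nhds (x := G v)).add (tendsto_one_div_add_atTop_nhds_zero_nat (𝕜 := ℝ))
    rw [add_zero] at h1
    exact le_of_tendsto_of_tendsto' ((tendsto_add_atTop_iff_nat 1).2 hGy) h1 hle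
  have h0 : dist y v ≤ 0 := by
    by_contra! h
    have := mul_pos hε h
    linarith
  exact (dist_le_zero.1 h0).symm

/-- Clears the quotient and the extended reals. The inequality is trivial at `y = x`, so the
punctured neighbourhood can be filled in, and isolated points need no separate treatment. -/
theorem isInfStationary_iff {F : Z → ℝ} {K : Set Z} {x : Z} :
    IsInfStationary F K x ↔
      x ∈ K ∧ ∀ ε : ℝ, 0 < ε → ∀ᶠ y in 𝓝[K] x, F x - ε * dist y x ≤ F y := by
  refine and_congr_right fun hx => ?_
  have key : ∀ ε : ℝ, ∀ y, y ≠ x →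
      (-ε ≤ (F y - F x) / dist y x ↔ F x - ε * dist y x ≤ F y) := by
    intro ε y hy
    rw [le_div_iff₀ (dist_pos.2 hy)]
    constructor <;> intro h <;> linarith
  have hsub : ∀ {p : Z → Prop}, (∀ᶠ y in 𝓝[K \ {x}] x, p y) → p x → ∀ᶠ y in 𝓝[K] x, p y := by
    intro p h hpx
    rw [eventually_nhdsWithin_iff] at h ⊢
    filter_upwards [h] with y hy hyK
    by_cases hyx : y = x
    · exact hyx ▸ hpx
    · exact hy ⟨hyK, hyx⟩
  constructor
  · intro h ε hε
    have h1 : ((-ε : ℝ) : EReal) < rateOfSteepestDescent F K x :=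
      lt_of_lt_of_le (by exact_mod_cast neg_lt_zero.2 hε) h
    refine hsub ?_ (by simp)
    filter_upwards [eventually_lt_of_lt_liminf h1, self_mem_nhdsWithin] with y hy hyK
    exact (key ε y hyK.2).1 (by exact_mod_cast hy.le)
  · intro h
    refine EReal.ge_of_forall_gt_iff_ge.1 fun r hr => ?_
    have hr' : r < 0 := by exact_mod_cast hr
    have hr' : 0 < -r := by linarith
    refine le_liminf_of_le (by isBoundedDefault) ?_
    filter_upwards [(h (-r) hr').filter_mono (nhdsWithin_mono _ sdiff_subset),
      self_mem_nhdsWithin] with y hy hyK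
    have := (key (-r) y hyK.2).2 hy
    rw [neg_neg] at this
    exact_mod_cast this

/-- A nonnegative function that can be decreased at rate `a` near `z` wherever it is positive
admits a local error bound. -/
theorem eventually_exists_dist_le_of_descent {φ : Z → ℝ} {A : Set Z} {a : ℝ} (hA : IsComplete A)
    (hφ : Continuous φ) (hφ0 : ∀ z, 0 ≤ φ z) (ha : 0 < a) {z : Z} (hz : φ z = 0)
    (hdesc : ∀ᶠ w in 𝓝 z, w ∈ A → 0 < φ w →
      ∃ᶠ v in 𝓝[A \ {w}] w, φ v + a * dist v w ≤ φ w)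
    {r : ℝ} (hr : 0 < r) :
    ∀ᶠ w in 𝓝[A] z, ∃ y ∈ A, φ y = 0 ∧ a * dist w y ≤ φ w ∧ dist y z < r := by
  obtain ⟨ρ, hρ, hball⟩ := Metric.eventually_nhds_iff.1 hdesc
  -- Half of the radius is for `dist w z`, half for the Ekeland displacement `dist w y ≤ φ w / a`.
  -- The Ekeland point then stays where descent is available, so `φ y > 0` would contradict its
  -- minimality.
  have hm : 0 < min ρ r / 2 := by positivity
  have h1 : ∀ᶠ w in 𝓝 z, φ w < a * (min ρ r / 2) :=
    hφ.continuousAt.eventually_lt continuousAt_const (by rw [hz]; positivity)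
  have h2 : ∀ᶠ w in 𝓝 z, dist w z < min ρ r / 2 := Metric.eventually_nhds_iff.2 ⟨_, hm, fun _ h => h⟩
  filter_upwards [self_mem_nhdsWithin, h1.filter_mono nhdsWithin_le_nhds,
    h2.filter_mono nhdsWithin_le_nhds] with w hw hw1 hw2
  obtain ⟨y, hyA, hy1, hy2⟩ := exists_ekeland hA hφ.continuousOn
    ⟨0, by rintro _ ⟨v, -, rfl⟩; exact hφ0 v⟩ ha hw
  have hy0 := hφ0 y
  have hwy : dist w y < min ρ r / 2 := lt_of_mul_lt_mul_left (by linarith) ha.le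
  have hyz : dist y z < min ρ r := by
    have := dist_triangle_left y z w
    linarith
  refine ⟨y, hyA, ?_, by linarith, hyz.trans_le (min_le_right _ _)⟩
  by_contra hne
  obtain ⟨v, hv, hvA, hvy⟩ :=
    ((hball (hyz.trans_le (min_le_left _ _)) hyA (lt_of_le_of_ne hy0 (Ne.symm hne))).and_eventually
      self_mem_nhdsWithin).exists
  exact hvy (hy2 v hvA (by rwa [dist_comm]))

/-- Complete exactness of the penalty function `J + lam * φ`: the cost is Lipschitz continuous with
a uniform constant near the points of a truncated sublevel set, and the penalty term can be
decreased at a uniform rate at the infeasible points of this set. -/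
theorem exists_isCompletelyExactOn {J φ : Z → ℝ} {A Ω : Set Z} {lam₀ c δ L a : ℝ}
    (hA : IsComplete A) (hφ : Continuous φ) (hφ0 : ∀ z, 0 ≤ φ z)
    (hΩ : ∀ z, z ∈ Ω ↔ z ∈ A ∧ φ z = 0) (hJ : Continuous J) (hlam₀ : 0 ≤ lam₀) (hδ : 0 < δ)
    (ha : 0 < a)
    (hlip : ∀ z ∈ A, J z + lam₀ * φ z < c → φ z < δ →
      ∃ O ∈ 𝓝 z, ∀ v ∈ O, ∀ w ∈ O, |J v - J w| ≤ L * dist v w)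
    (hdesc : ∀ z ∈ A, J z + lam₀ * φ z < c → φ z < δ → 0 < φ z →
      ∃ᶠ w in 𝓝[A \ {z}] z, φ w + a * dist w z ≤ φ z)
    (hbelow : BddBelow ((fun z => J z + lam₀ * φ z) '' A))
    (hc : optimalValue J Ω < (c : EReal)) :
    ∃ lamStar : ℝ, 0 ≤ lamStar ∧ ∀ lam : ℝ, lamStar ≤ lam →
      IsCompletelyExactOn J (fun z => J z + lam * φ z) Ω A
        {z | z ∈ A ∧ J z + lam * φ z < c} := by
  obtain ⟨γ, hγ⟩ := hbelow
  replace hγ : ∀ z ∈ A, γ ≤ J z + lam₀ * φ z := fun z hz => hγ ⟨z, hz, rfl⟩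
  -- If `φ z ≥ δ`, the second bound gives a penalty value at least `γ + (lam - lam₀) * δ ≥ c`, so
  -- the sublevel set lies in `φ < δ`. The third makes the gain `lam * a` exceed the Lipschitz loss
  -- `L` by 1.
  refine ⟨max (max lam₀ (lam₀ + (c - γ) / δ)) ((L + 1) / a), ?_, fun lam hlam => ?_⟩
  · exact hlam₀.trans ((le_max_left _ _).trans (le_max_left _ _))
  have hl1 : lam₀ ≤ lam := ((le_max_left _ _).trans (le_max_left _ _)).trans hlam
  have hl2 : lam₀ + (c - γ) / δ ≤ lam := ((le_max_right _ _).trans (le_max_left _ _)).trans hlam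
  have hl3 : L + 1 ≤ lam * a := (div_le_iff₀ ha).1 ((le_max_right _ _).trans hlam)
  have hl4 : c - γ ≤ (lam - lam₀) * δ := (div_le_iff₀ hδ).1 (by linarith)
  have hlam0 : 0 ≤ lam := hlam₀.trans hl1
  have hsub : ∀ z ∈ A, J z + lam * φ z < c → J z + lam₀ * φ z < c ∧ φ z < δ := by
    intro z hz hzc
    have h0 := hφ0 z
    refine ⟨by nlinarith, ?_⟩
    by_contra! h
    have := hγ z hz
    nlinarith [mul_le_mul_of_nonneg_left h (sub_nonneg.2 hl1)]
  have hΦ : Continuous fun z => J z + lam * φ z := hJ.add (continuous_const.mul hφ)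
  -- infeasible points of the sublevel set have a direction of descent
  have hdec : ∀ z ∈ A, J z + lam * φ z < c → z ∉ Ω →
      ∃ᶠ w in 𝓝[A \ {z}] z, J w + lam * φ w + dist w z ≤ J z + lam * φ z := by
    intro z hz hzc hzΩ
    obtain ⟨h1, h2⟩ := hsub z hz hzc
    have h3 : 0 < φ z := lt_of_le_of_ne (hφ0 z) fun h => hzΩ ((hΩ z).2 ⟨hz, h.symm⟩)
    obtain ⟨O, hO, hOL⟩ := hlip z hz h1 h2
    refine ((hdesc z hz h1 h2 h3).and_eventually (mem_nhdsWithin_of_mem_nhds hO)).mono ?_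
    rintro w ⟨hw, hwO⟩
    have h4 := (abs_le.1 (hOL w hwO z (mem_of_mem_nhds hO))).2
    have h5 := mul_le_mul_of_nonneg_left hw hlam0
    have h6 := mul_le_mul_of_nonneg_right hl3 (dist_nonneg (x := w) (y := z))
    nlinarith
  -- Any slope below the descent rate 1 would do in place of `2⁻¹`. Global minimisers, local
  -- minimisers and inf-stationary points all satisfy this condition.
  have hstat_mem : ∀ z ∈ A, J z + lam * φ z < c →
      (∀ᶠ w in 𝓝[A] z, J z + lam * φ z - 2⁻¹ * dist w z ≤ J w + lam * φ w) → z ∈ Ω := by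
    intro z hz hzc h
    by_contra hzΩ
    obtain ⟨w, ⟨h1, h2⟩, h3⟩ := (((hdec z hz hzc hzΩ).and_eventually
      (h.filter_mono (nhdsWithin_mono _ sdiff_subset))).and_eventually self_mem_nhdsWithin).exists
    have := dist_pos.2 h3.2
    linarith
  have hbdd : BddBelow ((fun z => J z + lam * φ z) '' A) := by
    refine ⟨γ, ?_⟩
    rintro _ ⟨z, hz, rfl⟩
    have := hγ z hz
    have := hφ0 z
    dsimp only
    nlinarith
  have heqΩ : ∀ z ∈ Ω, J z + lam * φ z = J z := fun z hz => by simp [((hΩ z).1 hz).2]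
  have hΩA : Ω ⊆ A := fun z hz => ((hΩ z).1 hz).1
  -- every value of the penalty function is at least the optimal value
  have hval : ∀ z ∈ A, optimalValue J Ω ≤ ((J z + lam * φ z : ℝ) : EReal) := by
    intro z hz
    by_contra! hlt
    -- The Ekeland point keeps a value below the optimum: it cannot be feasible, and if infeasible
    -- it admits descent at rate 1, against its minimality.
    obtain ⟨y, hyA, hy1, hy2⟩ := exists_ekeland hA hΦ.continuousOn hbdd one_pos hz
    have hyz : J y + lam * φ y ≤ J z + lam * φ z := by
      have := dist_nonneg (x := z) (y := y)
      linarith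
    have hylt : ((J y + lam * φ y : ℝ) : EReal) < optimalValue J Ω :=
      lt_of_le_of_lt (by exact_mod_cast hyz) hlt
    have hyc : J y + lam * φ y < c := by exact_mod_cast hylt.trans hc
    by_cases hyΩ : y ∈ Ω
    · rw [heqΩ y hyΩ] at hylt
      exact absurd (iInf₂_le y hyΩ) (not_le.2 hylt)
    · obtain ⟨v, hv, hvA, hvy⟩ :=
        ((hdec y hyA hyc hyΩ).and_eventually self_mem_nhdsWithin).exists
      exact hvy (hy2 v hvA (by rw [dist_comm]; linarith))
  -- near a feasible point, the penalty function dominates the cost at nearby feasible points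
  have hnear : ∀ z ∈ Ω, J z + lam * φ z < c → ∀ r : ℝ, 0 < r →
      ∀ᶠ w in 𝓝[A] z, ∃ y ∈ Ω, dist y z < r ∧ J y + dist w y ≤ J w + lam * φ w := by
    intro z hz hzc r hr
    obtain ⟨hzA, hz0⟩ := (hΩ z).1 hz
    obtain ⟨h1, h2⟩ := hsub z hzA hzc
    obtain ⟨O, hO, hOL⟩ := hlip z hzA h1 h2
    obtain ⟨ρ, hρ, hρO⟩ := Metric.mem_nhds_iff.1 hO
    have hcont : ∀ᶠ w in 𝓝 z, w ∈ A → 0 < φ w →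
        ∃ᶠ v in 𝓝[A \ {w}] w, φ v + a * dist v w ≤ φ w := by
      filter_upwards [(hJ.add (continuous_const.mul hφ)).continuousAt.eventually_lt
        continuousAt_const h1, hφ.continuousAt.eventually_lt continuousAt_const h2]
        with w hw1 hw2 hwA hw0
      exact hdesc w hwA hw1 hw2 hw0
    filter_upwards [eventually_exists_dist_le_of_descent hA hφ hφ0 ha hz0 hcont (lt_min hρ hr),
      mem_nhdsWithin_of_mem_nhds hO] with w hw hwO
    obtain ⟨y, hyA, hy0, hy1, hy2⟩ := hw
    refine ⟨y, (hΩ y).2 ⟨hyA, hy0⟩, hy2.trans_le (min_le_right _ _), ?_⟩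
    have h4 := (abs_le.1 (hOL w hwO y (hρO (hy2.trans_le (min_le_left _ _))))).1
    have h5 := mul_le_mul_of_nonneg_left hy1 hlam0
    have h6 := mul_le_mul_of_nonneg_right hl3 (dist_nonneg (x := w) (y := y))
    nlinarith
  have hopt : ∀ z, IsGlobalSolution J Ω z → optimalValue J Ω = (J z : EReal) := fun z hz =>
    le_antisymm (iInf₂_le z hz.1) (le_iInf₂ fun y hy => by exact_mod_cast hz.2 y hy)
  refine ⟨?_, fun z => ?_, fun z hz => ?_, fun z hz => ?_⟩
  · refine le_antisymm (le_iInf₂ fun z hz => ?_) (le_iInf₂ hval)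
    rw [← heqΩ z hz]
    exact iInf₂_le z (hΩA hz)
  · constructor
    · rintro ⟨hzA, hzmin⟩
      have hle : ((J z + lam * φ z : ℝ) : EReal) ≤ optimalValue J Ω := by
        refine le_iInf₂ fun y hy => ?_
        rw [← heqΩ y hy]
        exact_mod_cast hzmin y (hΩA hy)
      have hzc : J z + lam * φ z < c := by exact_mod_cast hle.trans_lt hc
      have hzΩ : z ∈ Ω := by
        refine hstat_mem z hzA hzc ?_
        filter_upwards [self_mem_nhdsWithin] with w hw
        have := hzmin w hw
        have := dist_nonneg (x := w) (y := z)
        linarith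
      refine ⟨hzΩ, fun y hy => ?_⟩
      rw [← heqΩ z hzΩ, ← heqΩ y hy]
      exact hzmin y (hΩA hy)
    · intro hz
      refine ⟨hΩA hz.1, fun y hy => ?_⟩
      have := hval y hy
      rw [hopt z hz] at this
      dsimp only
      rw [heqΩ z hz.1]
      exact_mod_cast this
  · constructor
    · rintro ⟨-, hmin⟩
      have hzΩ : z ∈ Ω := by
        refine hstat_mem z hz.1 hz.2 ?_
        filter_upwards [hmin] with w hw
        have := dist_nonneg (x := w) (y := z)
        linarith
      refine ⟨hzΩ, hzΩ, ?_⟩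
      filter_upwards [hmin.filter_mono (nhdsWithin_mono _ hΩA), self_mem_nhdsWithin] with w hw hwΩ
      rwa [heqΩ z hzΩ, heqΩ w hwΩ] at hw
    · rintro ⟨hzΩ, -, hmin⟩
      refine ⟨hz.1, ?_⟩
      obtain ⟨r, hr, hball⟩ := Metric.eventually_nhds_iff.1 (eventually_nhdsWithin_iff.1 hmin)
      filter_upwards [hnear z hzΩ hz.2 r hr] with w hw
      obtain ⟨y, hyΩ, hyr, hy⟩ := hw
      have h1 := hball hyr hyΩ
      have h2 := dist_nonneg (x := w) (y := y)
      rw [heqΩ z hzΩ]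
      linarith
  · rw [isInfStationary_iff, isInfStationary_iff]
    constructor
    · rintro ⟨-, hst⟩
      have hzΩ : z ∈ Ω := hstat_mem z hz.1 hz.2 (hst 2⁻¹ (by norm_num))
      refine ⟨hzΩ, hzΩ, fun ε hε => ?_⟩
      filter_upwards [(hst ε hε).filter_mono (nhdsWithin_mono _ hΩA), self_mem_nhdsWithin]
        with w hw hwΩ
      rwa [heqΩ z hzΩ, heqΩ w hwΩ] at hw
    · rintro ⟨hzΩ, -, hst⟩
      refine ⟨hz.1, fun ε hε => ?_⟩
      -- With `η ≤ 1`, the detour through `y` in `η * dist y z ≤ η * (dist w y + dist w z)` is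
      -- absorbed by the surplus `dist w y`.
      have hη : 0 < min ε 1 := lt_min hε one_pos
      obtain ⟨r, hr, hball⟩ :=
        Metric.eventually_nhds_iff.1 (eventually_nhdsWithin_iff.1 (hst _ hη))
      filter_upwards [hnear z hzΩ hz.2 r hr] with w hw
      obtain ⟨y, hyΩ, hyr, hy⟩ := hw
      have h1 := hball hyr hyΩ
      have h2 := dist_nonneg (x := w) (y := y)
      have h3 := dist_nonneg (x := w) (y := z)
      have h4 := mul_le_mul_of_nonneg_left (dist_triangle_left y z w) hη.le
      have h5 := mul_le_mul_of_nonneg_right (min_le_left ε 1) h3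
      have h6 := mul_le_mul_of_nonneg_right (min_le_right ε 1) h2
      rw [heqΩ z hzΩ]
      nlinarith

end Abstract

/-! ### Absolutely continuous vector functions and their derivatives -/

section AbsolutelyContinuous

variable {E : Type*} [NormedAddCommGroup E] [NormedSpace ℝ E]

theorem _root_.AbsolutelyContinuousOnInterval.of_dist_le {X Y : Type*} [PseudoMetricSpace X]
    [PseudoMetricSpace Y] {F : ℝ → X} {G : ℝ → Y} {a b : ℝ}
    (hG : AbsolutelyContinuousOnInterval G a b)
    (h : ∀ s ∈ uIcc a b, ∀ t ∈ uIcc a b, dist (F s) (F t) ≤ dist (G s) (G t)) :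
    AbsolutelyContinuousOnInterval F a b := by
  rw [absolutelyContinuousOnInterval_iff] at hG ⊢
  intro ε hε
  obtain ⟨δ, hδ, H⟩ := hG ε hε
  refine ⟨δ, hδ, fun I hI hIδ => lt_of_le_of_lt ?_ (H I hI hIδ)⟩
  exact Finset.sum_le_sum fun i hi => h _ (hI.1 i hi).1 _ (hI.1 i hi).2

/-- The increments are dominated by those of the scalar primitive of `‖v‖`. -/
theorem absolutelyContinuousOnInterval_integral {v : ℝ → E} {a b c : ℝ}
    (hv : IntervalIntegrable v volume a b) (hc : c ∈ uIcc a b) :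
    AbsolutelyContinuousOnInterval (fun t => ∫ s in c..t, v s) a b := by
  refine (hv.norm.absolutelyContinuousOnInterval_intervalIntegral hc).of_dist_le ?_
  intro s hs t ht
  have hsub : ∀ s ∈ uIcc a b, IntervalIntegrable v volume c s := fun s hs =>
    hv.mono_set (uIcc_subset_uIcc hc hs)
  rw [dist_eq_norm, dist_eq_norm,
    intervalIntegral.integral_interval_sub_left (hsub s hs) (hsub t ht),
    intervalIntegral.integral_interval_sub_left (hsub s hs).norm (hsub t ht).norm]
  exact intervalIntegral.norm_integral_le_abs_integral_norm

/-- The difference between `x` and the primitive of its derivative is absolutely continuous with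
zero derivative almost everywhere, hence constant. -/
theorem _root_.AbsolutelyContinuousOnInterval.integral_deriv_eq_sub_of_intervalIntegrable
    {d : ℕ} {x : ℝ → Vec d} {a b : ℝ} (hx : AbsolutelyContinuousOnInterval x a b)
    (hx' : IntervalIntegrable (deriv x) volume a b) :
    ∫ s in a..b, deriv x s = x b - x a := by
  have hac := hx.sub (absolutelyContinuousOnInterval_integral hx' (left_mem_uIcc))
  obtain ⟨C, hC⟩ := hac.const_of_ae_hasDerivAt_zero (by
    filter_upwards [hx.boundedVariationOn.ae_differentiableAt_of_mem_uIcc,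
      hx'.ae_hasDerivAt_integral] with t h1 h2 ht
    have := (h1 ht).hasDerivAt.sub (h2 ht a left_mem_uIcc)
    rwa [sub_self] at this)
  have h1 := hC a left_mem_uIcc
  have h2 := hC b right_mem_uIcc
  simp only [Pi.sub_apply, intervalIntegral.integral_same, sub_zero] at h1 h2
  rw [h1, ← h2]
  abel

end AbsolutelyContinuous

/-! ### Integrability on the time interval -/

section TimeMeasure

variable {T : ℝ} {E : Type*} [NormedAddCommGroup E]

/-- The norm of the embedding of `Lᵖ(0, T)` into `L¹(0, T)`. -/
def embConst (p : ℝ≥0∞) (T : ℝ) : ℝ :=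
  ((timeMeasure T) univ ^ (1 / (1 : ℝ≥0∞).toReal - 1 / p.toReal)).toReal

theorem embConst_nonneg (p : ℝ≥0∞) (T : ℝ) : 0 ≤ embConst p T := ENNReal.toReal_nonneg

theorem integral_norm_le_embConst_mul {p : ℝ≥0∞} (hp : 1 ≤ p) {g : ℝ → E}
    (hg : MemLp g p (timeMeasure T)) :
    ∫ t, ‖g t‖ ∂(timeMeasure T) ≤ embConst p T * (eLpNorm g p (timeMeasure T)).toReal := by
  have h1 : ∫ t, ‖g t‖ ∂(timeMeasure T) = (eLpNorm g 1 (timeMeasure T)).toReal := by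
    rw [integral_norm_eq_lintegral_enorm hg.1, eLpNorm_one_eq_lintegral_enorm]
  rw [h1, embConst, mul_comm, ← ENNReal.toReal_mul]
  refine ENNReal.toReal_mono (ENNReal.mul_ne_top hg.2.ne ?_)
    (eLpNorm_le_eLpNorm_mul_rpow_measure_univ hp hg.1)
  refine ENNReal.rpow_ne_top_of_nonneg ?_ (measure_ne_top _ _)
  rw [ENNReal.toReal_one, div_one, sub_nonneg, one_div]
  rcases eq_or_ne p ∞ with rfl | hp'
  · simp
  · refine inv_le_one_of_one_le₀ ?_
    rw [← ENNReal.toReal_one]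
    exact ENNReal.toReal_mono hp' hp

theorem intervalIntegrable_of_integrable_timeMeasure {g : ℝ → E} (hg : Integrable g (timeMeasure T))
    {s t : ℝ} (hs : s ∈ Icc 0 T) (ht : t ∈ Icc 0 T) : IntervalIntegrable g volume s t := by
  have hg' : IntegrableOn g (Icc 0 T) := hg
  exact intervalIntegrable_iff.2 (hg'.mono_set
    (uIoc_subset_uIcc.trans (uIcc_subset_Icc hs ht)))

end TimeMeasure

/-! ### Embedding and completeness of the Sobolev space -/

namespace SobolevSpace

variable {d : ℕ} {p : ℝ≥0∞} {T : ℝ}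

theorem coe_sub (x y : SobolevSpace d p T) : ((x - y : SobolevSpace d p T) : ℝ → Vec d) = x - y :=
  rfl

theorem clamp_mem (hT : 0 ≤ T) (t : ℝ) : max 0 (min T t) ∈ Icc 0 T :=
  ⟨le_max_left _ _, max_le hT (min_le_left _ _)⟩

/-- The derivative, as an element of `Lᵖ`. -/
def derivLp : SobolevSpace d p T →+ Lp (Vec d) p (timeMeasure T) where
  toFun x := x.memLp_deriv.toLp
  map_zero' := by
    have h : deriv ((0 : SobolevSpace d p T) : ℝ → Vec d) = 0 := by
      ext1 t; exact deriv_const t (0 : Vec d)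
    simp only [h]
    exact MemLp.toLp_zero _
  map_add' x y := by
    rw [← MemLp.toLp_add, MemLp.toLp_eq_toLp_iff]
    exact deriv_add_ae x.ac y.ac

theorem coeFn_derivLp (x : SobolevSpace d p T) : derivLp x =ᵐ[timeMeasure T] deriv x :=
  x.memLp_deriv.coeFn_toLp

theorem norm_derivLp (x : SobolevSpace d p T) :
    ‖derivLp x‖ = (eLpNorm (deriv x) p (timeMeasure T)).toReal :=
  Lp.norm_toLp _ x.memLp_deriv

variable [Fact (1 ≤ p)]

theorem integrable_deriv (x : SobolevSpace d p T) : Integrable (deriv x) (timeMeasure T) :=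
  x.memLp_deriv.integrable Fact.out

theorem norm_sub_le_integral (x : SobolevSpace d p T) {s t : ℝ} (hs : s ∈ Icc 0 T)
    (ht : t ∈ Icc 0 T) : ‖x t - x s‖ ≤ embConst p T * ‖derivLp x‖ := by
  have h0 : (0 : ℝ) ≤ T := hs.1.trans hs.2
  have hsub : uIcc s t ⊆ Icc 0 T := uIcc_subset_Icc hs ht
  rw [← (x.ac.mono (hsub.trans Icc_subset_uIcc)).integral_deriv_eq_sub_of_intervalIntegrable
    (intervalIntegrable_of_integrable_timeMeasure x.integrable_deriv hs ht), norm_derivLp]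
  refine (intervalIntegral.norm_integral_le_integral_norm_uIoc).trans
    (le_trans ?_ (integral_norm_le_embConst_mul Fact.out x.memLp_deriv))
  exact setIntegral_mono_set x.integrable_deriv.norm (Eventually.of_forall fun _ => norm_nonneg _)
    (uIoc_subset_uIcc.trans hsub).eventuallyLE

variable [Fact (0 < T)]

theorem norm_derivLp_le (x : SobolevSpace d p T) : ‖derivLp x‖ ≤ ‖x‖ := by
  rw [norm_def, norm_derivLp]
  exact le_add_of_nonneg_left ENNReal.toReal_nonneg

/-- The embedding of the Sobolev space into the space of bounded functions. -/
theorem exists_norm_apply_le (d : ℕ) (p : ℝ≥0∞) (T : ℝ) [Fact (1 ≤ p)] [Fact (0 < T)] :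
    ∃ K : ℝ, 0 ≤ K ∧ ∀ (x : SobolevSpace d p T) (t : ℝ), ‖x t‖ ≤ K * ‖x‖ := by
  have hT : 0 < T := Fact.out
  have hM := embConst_nonneg p T
  refine ⟨embConst p T / T + embConst p T, by positivity, fun x t => ?_⟩
  rw [x.apply_eq t]
  set τ := max 0 (min T t)
  have hτ : τ ∈ Icc 0 T := clamp_mem hT.le t
  -- Averages over `s` the bound of `‖x τ‖` by `‖x s‖` plus the oscillation; dividing by `T` gives
  -- the first part of the constant.
  have h1 : ∫ s in Icc 0 T, (‖x τ‖ - embConst p T * ‖derivLp x‖) ≤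
      embConst p T * (eLpNorm x p (timeMeasure T)).toReal := by
    refine le_trans ?_ (integral_norm_le_embConst_mul Fact.out x.memLp)
    refine setIntegral_mono_on (integrable_const _) (x.memLp.integrable Fact.out).norm
      measurableSet_Icc fun s hs => ?_
    have h2 := x.norm_sub_le_integral hs hτ
    have h3 := norm_sub_norm_le (x τ) (x s)
    linarith
  rw [setIntegral_const, smul_eq_mul, Real.volume_real_Icc_of_le hT.le, sub_zero] at h1
  have h4 : ‖x τ‖ ≤ embConst p T / T * (eLpNorm x p (timeMeasure T)).toReal
      + embConst p T * ‖derivLp x‖ := by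
    rw [div_mul_eq_mul_div, ← sub_le_iff_le_add, le_div_iff₀ hT]
    linarith
  refine h4.trans ?_
  rw [norm_def, ← norm_derivLp, add_mul, mul_add, mul_add]
  have h5 : 0 ≤ embConst p T / T * ‖derivLp x‖ := by positivity
  have h6 : 0 ≤ embConst p T * (eLpNorm x p (timeMeasure T)).toReal := by positivity
  linarith

/-- With `exists_primitive`, this identifies the space, up to equivalent norms, with the pairs of an
initial value and a derivative in `Lᵖ`; completeness is inherited from there. -/
theorem exists_norm_le (d : ℕ) (p : ℝ≥0∞) (T : ℝ) [Fact (1 ≤ p)] [Fact (0 < T)] :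
    ∃ K : ℝ, ∀ x : SobolevSpace d p T, ‖x‖ ≤ K * (‖x 0‖ + ‖derivLp x‖) := by
  have hT : 0 < T := Fact.out
  have hM := embConst_nonneg p T
  set N := (eLpNorm (fun _ : ℝ => (1 : ℝ)) p (timeMeasure T)).toReal
  have hN0 : 0 ≤ N := ENNReal.toReal_nonneg
  refine ⟨N * (1 + embConst p T) + 1, fun x => ?_⟩
  have h1 : (eLpNorm x p (timeMeasure T)).toReal ≤ (‖x 0‖ + embConst p T * ‖derivLp x‖) * N := by
    have h2 : eLpNorm x p (timeMeasure T) ≤ ENNReal.ofReal (‖x 0‖ + embConst p T * ‖derivLp x‖) *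
        eLpNorm (fun _ : ℝ => (1 : ℝ)) p (timeMeasure T) := by
      refine eLpNorm_le_mul_eLpNorm_of_ae_le_mul ?_ p
      refine (ae_restrict_iff' measurableSet_Icc).2 (Eventually.of_forall fun t ht => ?_)
      rw [norm_one, mul_one]
      have h3 := x.norm_sub_le_integral (left_mem_Icc.2 hT.le) ht
      have h4 := norm_sub_norm_le (x t) (x 0)
      linarith
    have h5 := ENNReal.toReal_mono (ENNReal.mul_ne_top ENNReal.ofReal_ne_top
      (memLp_const (1 : ℝ)).2.ne) h2
    rwa [ENNReal.toReal_mul, ENNReal.toReal_ofReal (by positivity)] at h5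
  rw [norm_def, ← norm_derivLp]
  have h6 : 0 ≤ embConst p T * ‖x 0‖ * N := by positivity
  have h7 : 0 ≤ ‖derivLp x‖ * N := by positivity
  have h8 := norm_nonneg (x 0)
  nlinarith

theorem exists_primitive (a : Vec d) (v : Lp (Vec d) p (timeMeasure T)) :
    ∃ x : SobolevSpace d p T, x 0 = a ∧ derivLp x = v := by
  have hT : 0 < T := Fact.out
  have hv : Integrable v (timeMeasure T) := (Lp.memLp v).integrable Fact.out
  have h0 : (0 : ℝ) ∈ Icc 0 T := left_mem_Icc.2 hT.le
  have hvi : IntervalIntegrable v volume 0 T :=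
    intervalIntegrable_of_integrable_timeMeasure hv h0 (right_mem_Icc.2 hT.le)
  let X : ℝ → Vec d := fun t => a + ∫ s in (0 : ℝ)..(max 0 (min T t)), v s
  have hclamp : ∀ t ∈ Icc 0 T, max 0 (min T t) = t := fun t ht => by
    rw [min_eq_right ht.2, max_eq_right ht.1]
  have hac : AbsolutelyContinuousOnInterval X 0 T := by
    refine (absolutelyContinuousOnInterval_integral hvi left_mem_uIcc).of_dist_le ?_
    intro s hs t ht
    rw [uIcc_of_le hT.le] at hs ht
    simp only [X, hclamp s hs, hclamp t ht, dist_add_left, le_refl]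
  have hderiv : deriv X =ᵐ[timeMeasure T] v := by
    -- The clamped function agrees with the primitive on a whole neighbourhood of `t` only for
    -- interior `t`; the endpoints are null.
    have hIoo : ∀ᵐ t ∂(timeMeasure T), t ∈ Ioo 0 T := by
      rw [timeMeasure, ← restrict_Ioo_eq_restrict_Icc]
      exact ae_restrict_mem measurableSet_Ioo
    filter_upwards [hIoo, ae_restrict_of_ae hvi.ae_hasDerivAt_integral] with t ht h1
    have h2 := (h1 (Icc_subset_uIcc (Ioo_subset_Icc_self ht)) 0 left_mem_uIcc).const_add a
    refine (h2.congr_of_eventuallyEq ?_).deriv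
    filter_upwards [Ioo_mem_nhds ht.1 ht.2] with s hs
    simp only [X, hclamp s (Ioo_subset_Icc_self hs)]
  let x : SobolevSpace d p T := ⟨X, hac, (Lp.memLp v).ae_eq hderiv.symm, fun t => by
    simp only [X, hclamp _ (clamp_mem hT.le t)]⟩
  refine ⟨x, ?_, ?_⟩
  · change X 0 = a
    simp only [X, hclamp 0 h0, intervalIntegral.integral_same, add_zero]
  · exact Lp.ext (x.coeFn_derivLp.trans hderiv)

instance : CompleteSpace (SobolevSpace d p T) := by
  obtain ⟨K, hK0, hK⟩ := exists_norm_apply_le d p T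
  obtain ⟨M, hM⟩ := exists_norm_le d p T
  refine Metric.complete_of_cauchySeq_tendsto fun u hu => ?_
  have h1 : CauchySeq fun n => derivLp (u n) := by
    refine (LipschitzWith.of_dist_le_mul (K := 1) fun x y => ?_).uniformContinuous.comp_cauchySeq hu
    rw [dist_eq_norm, dist_eq_norm, ← map_sub, NNReal.coe_one, one_mul]
    exact norm_derivLp_le _
  have h2 : CauchySeq fun n => u n 0 := by
    refine (LipschitzWith.of_dist_le_mul (K := ⟨K, hK0⟩) (f := fun x : SobolevSpace d p T => x 0)
      fun x y => ?_).uniformContinuous.comp_cauchySeq hu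
    rw [dist_eq_norm, dist_eq_norm]
    exact hK (x - y) 0
  obtain ⟨v, hv⟩ := cauchySeq_tendsto_of_complete h1
  obtain ⟨a, ha⟩ := cauchySeq_tendsto_of_complete h2
  obtain ⟨x, rfl, rfl⟩ := exists_primitive a v
  refine ⟨x, tendsto_iff_norm_sub_tendsto_zero.2 (squeeze_zero (fun _ => norm_nonneg _)
    (fun n => hM (u n - x)) ?_)⟩
  have h3 := ((tendsto_iff_norm_sub_tendsto_zero.1 ha).add
    (tendsto_iff_norm_sub_tendsto_zero.1 hv)).const_mul M
  simp only [← map_sub] at h3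
  simpa [coe_sub] using h3

theorem continuous_apply (t : ℝ) : Continuous fun x : SobolevSpace d p T => x t := by
  obtain ⟨K, hK0, hK⟩ := exists_norm_apply_le d p T
  refine (LipschitzWith.of_dist_le_mul (K := ⟨K, hK0⟩) fun x y => ?_).continuous
  rw [dist_eq_norm, dist_eq_norm]
  exact hK (x - y) t

theorem continuous_derivLp : Continuous (derivLp : SobolevSpace d p T →+ _) := by
  refine (LipschitzWith.of_dist_le_mul (K := 1) fun x y => ?_).continuous
  rw [dist_eq_norm, dist_eq_norm, ← map_sub, NNReal.coe_one, one_mul]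
  exact norm_derivLp_le _

end SobolevSpace

/-! ### Closedness of the admissible set -/

namespace ControlProblem

variable {d m : ℕ} {p q : ℝ≥0∞} {T : ℝ} [Fact (1 ≤ p)] [Fact (1 ≤ q)] [Fact (0 < T)]

/-- States converge pointwise; derivatives and controls converge almost everywhere along a
subsequence, extracted in two stages. Continuity of `f` then passes the differential equation to the
limit. -/
theorem isClosed_admissible (P : ControlProblem d m q T) (hU : IsClosed P.U)
    (hf : ContinuousOnTime T P.f) : IsClosed (P.admissible p) := by
  refine IsSeqClosed.isClosed fun z w hz hw => ?_
  have hx : Tendsto (fun n => (z n).fst) atTop (𝓝 w.fst) :=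
    ((WithLp.prod_continuous_ofLp 1 _ _).fst.tendsto w).comp hw
  have hu : Tendsto (fun n => (z n).snd) atTop (𝓝 w.snd) :=
    ((WithLp.prod_continuous_ofLp 1 _ _).snd.tendsto w).comp hw
  have hxt : ∀ t, Tendsto (fun n => (z n).fst t) atTop (𝓝 (w.fst t)) := fun t =>
    ((SobolevSpace.continuous_apply t).tendsto w.fst).comp hx
  have hdx := (SobolevSpace.continuous_derivLp.tendsto w.fst).comp hx
  refine ⟨?_, hU.isSeqClosed (fun n => (hz n).2.1) hu, ?_⟩
  · refine tendsto_nhds_unique (hxt 0) ?_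
    simp only [fun n => (hz n).1, tendsto_const_nhds]
  obtain ⟨ns, hns, h1⟩ := (tendstoInMeasure_of_tendsto_Lp hdx).exists_seq_tendsto_ae
  obtain ⟨ks, hks, h2⟩ := (tendstoInMeasure_of_tendsto_Lp
    (hu.comp hns.tendsto_atTop)).exists_seq_tendsto_ae
  filter_upwards [h1, h2, ae_all_iff.2 fun n => (hz n).2.2,
    ae_all_iff.2 fun n => (z n).fst.coeFn_derivLp, w.fst.coeFn_derivLp,
    ae_restrict_mem measurableSet_Icc] with t h1 h2 h3 h4 h5 ht
  have hlim : Tendsto (fun i => ((z (ns (ks i))).fst t, (z (ns (ks i))).snd t, t)) atTop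
      (𝓝[{y : Vec d × Vec m × ℝ | y.2.2 ∈ Icc 0 T}] (w.fst t, w.snd t, t)) := by
    refine tendsto_nhdsWithin_iff.2 ⟨?_, Eventually.of_forall fun _ => ht⟩
    exact ((hxt t).comp (hns.tendsto_atTop.comp hks.tendsto_atTop)).prodMk_nhds
      (h2.prodMk_nhds tendsto_const_nhds)
  have hF := (hf (w.fst t, w.snd t, t) ht).tendsto.comp hlim
  refine h5.symm.trans (tendsto_nhds_unique (h1.comp hks.tendsto_atTop) ?_)
  refine hF.congr fun i => ?_
  simp only [Function.comp_apply]
  rw [h4, h3]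

end ControlProblem

/-! ### Lipschitz continuity of the cost on bounded sets -/

section Cost

variable {d m : ℕ} {p q q' : ℝ≥0∞} {T : ℝ}

/-- A bound on the increment of a function of `(x, u, t)` in terms of bounds on its partial
gradients. -/
theorem abs_sub_le_of_norm_grad_le {θ : Vec d → Vec m → ℝ → ℝ} {t R ρ a b : ℝ}
    (hdx : ∀ x u, DifferentiableAt ℝ (fun y => θ y u t) x)
    (hdu : ∀ x u, DifferentiableAt ℝ (fun v => θ x v t) u) {x y : Vec d} {u v : Vec m}
    (hx : ‖x‖ ≤ R) (hy : ‖y‖ ≤ R) (hu : ‖u‖ ≤ ρ) (hv : ‖v‖ ≤ ρ)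
    (ha : ∀ ξ, ‖ξ‖ ≤ R → ‖gradX θ ξ u t‖ ≤ a) (hb : ∀ η, ‖η‖ ≤ ρ → ‖gradU θ y η t‖ ≤ b) :
    |θ x u t - θ y v t| ≤ a * ‖x - y‖ + b * ‖u - v‖ := by
  -- The state moves first with `u` frozen, then the control with `y` frozen; convex balls contain
  -- both segments.
  have h1 : ‖θ x u t - θ y u t‖ ≤ a * ‖x - y‖ := by
    refine (convex_closedBall (0 : Vec d) R).norm_image_sub_le_of_norm_fderiv_le (𝕜 := ℝ)
      (f := fun y => θ y u t) (fun ξ _ => hdx ξ u) (fun ξ hξ => ?_) (by simpa using hy)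
      (by simpa using hx)
    have := ha ξ (by simpa using hξ)
    rwa [gradX, gradient, LinearIsometryEquiv.norm_map] at this
  have h2 : ‖θ y u t - θ y v t‖ ≤ b * ‖u - v‖ := by
    refine (convex_closedBall (0 : Vec m) ρ).norm_image_sub_le_of_norm_fderiv_le (𝕜 := ℝ)
      (f := fun v => θ y v t) (fun η _ => hdu y η) (fun η hη => ?_) (by simpa using hv)
      (by simpa using hu)
    have := hb η (by simpa using hη)
    rwa [gradU, gradient, LinearIsometryEquiv.norm_map] at this
  rw [Real.norm_eq_abs] at h1 h2
  exact (abs_sub_le _ (θ y u t) _).trans (add_le_add h1 h2)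

theorem ContinuousOnTime.exists_bound {F : Type*} [NormedAddCommGroup F]
    {g : Vec d → Vec m → ℝ → F} (hg : ContinuousOnTime T g) (R ρ : ℝ) :
    ∃ C : ℝ, 0 ≤ C ∧ ∀ x u, ∀ t ∈ Icc 0 T, ‖x‖ ≤ R → ‖u‖ ≤ ρ → ‖g x u t‖ ≤ C := by
  have hK : IsCompact (Metric.closedBall (0 : Vec d) R ×ˢ Metric.closedBall (0 : Vec m) ρ ×ˢ
      Icc 0 T) :=
    (isCompact_closedBall _ _).prod ((isCompact_closedBall _ _).prod isCompact_Icc)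
  obtain ⟨C, hC⟩ := hK.exists_bound_of_continuousOn (hg.mono fun w hw => hw.2.2)
  refine ⟨max C 0, le_max_right _ _, fun x u t ht hx hu => ?_⟩
  exact (hC (x, u, t) ⟨by simpa using hx, by simpa using hu, ht⟩).trans (le_max_left _ _)

section Integrals

variable {E : Type*} [NormedAddCommGroup E] {μ : Measure ℝ}

theorem integral_norm_eq_toReal_eLpNorm {g : ℝ → E} (hg : AEStronglyMeasurable g μ) :
    ∫ t, ‖g t‖ ∂μ = (eLpNorm g 1 μ).toReal := by
  rw [integral_norm_eq_lintegral_enorm hg, eLpNorm_one_eq_lintegral_enorm]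

theorem integrable_and_integral_mul_norm_le [ENNReal.HolderConjugate q' q] {b : ℝ → ℝ} {g : ℝ → E}
    (hb : MemLp b q' μ) (hg : MemLp g q μ) :
    Integrable (fun t => b t * ‖g t‖) μ ∧
      ∫ t, b t * ‖g t‖ ∂μ ≤ (eLpNorm b q' μ).toReal * (eLpNorm g q μ).toReal := by
  have h1 : MemLp (fun t => b t * ‖g t‖) 1 μ := hg.norm.mul' hb
  refine ⟨memLp_one_iff_integrable.1 h1, ?_⟩
  calc ∫ t, b t * ‖g t‖ ∂μ ≤ ∫ t, ‖b t * ‖g t‖‖ ∂μ :=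
        integral_mono (memLp_one_iff_integrable.1 h1) (memLp_one_iff_integrable.1 h1).norm
          fun t => le_abs_self _
    _ = (eLpNorm (fun t => b t * ‖g t‖) 1 μ).toReal := integral_norm_eq_toReal_eLpNorm h1.1
    _ ≤ (eLpNorm b q' μ * eLpNorm g q μ).toReal := by
        refine ENNReal.toReal_mono (ENNReal.mul_ne_top hb.2.ne hg.2.ne) ?_
        have h2 := eLpNorm_smul_le_mul_eLpNorm (p := q') (q := q) (r := 1)
          (f := fun t => ‖g t‖) (φ := b) hg.norm.1 hb.1
        rw [eLpNorm_norm] at h2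
        exact h2
    _ = _ := ENNReal.toReal_mul

theorem integral_norm_rpow_toReal {g : ℝ → E} (hq : 1 ≤ q) (hq' : q ≠ ∞) (hg : MemLp g q μ) :
    ∫ t, ‖g t‖ ^ q.toReal ∂μ = (eLpNorm g q μ).toReal ^ q.toReal := by
  have hq0 : q ≠ 0 := (zero_lt_one.trans_le hq).ne'
  have hpos : 0 < q.toReal := ENNReal.toReal_pos hq0 hq'
  have h1 := integral_norm_eq_toReal_eLpNorm (hg.norm_rpow hq0 hq').1
  rw [eLpNorm_norm_rpow _ hpos, one_mul, ENNReal.ofReal_toReal hq', ← ENNReal.toReal_rpow] at h1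
  rw [← h1]
  refine integral_congr_ae (Eventually.of_forall fun t => ?_)
  simp only [Real.norm_eq_abs]
  rw [abs_of_nonneg (Real.rpow_nonneg (norm_nonneg _) _)]

/-- Since `q' * (q - 1) = q`, the growth bound on `gradU` lies in the space dual to the controls.
For `q = 1` the power is the constant 1 and `q' = ∞`. -/
theorem memLp_rpow_sub_one [hc : ENNReal.HolderConjugate q' q] (hq' : q ≠ ∞) {ρ : ℝ → ℝ}
    (hρ : MemLp ρ q μ) {M : ℝ} (hM : (eLpNorm ρ q μ).toReal ≤ M) :
    MemLp (fun t => ‖ρ t‖ ^ (q.toReal - 1)) q' μ ∧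
      (eLpNorm (fun t => ‖ρ t‖ ^ (q.toReal - 1)) q' μ).toReal ≤ M ^ (q.toReal - 1) := by
  have hmeas : AEStronglyMeasurable (fun t => ‖ρ t‖ ^ (q.toReal - 1)) μ :=
    (hρ.1.norm.aemeasurable.pow_const _).aestronglyMeasurable
  suffices h : eLpNorm (fun t => ‖ρ t‖ ^ (q.toReal - 1)) q' μ ≤ eLpNorm ρ q μ ^ (q.toReal - 1) by
    have hq1 : 1 ≤ q := ENNReal.HolderConjugate.one_le q q'
    have hq1 : 0 ≤ q.toReal - 1 := by
      rw [sub_nonneg, ← ENNReal.toReal_one]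
      exact ENNReal.toReal_mono hq' hq1
    have hfin := ENNReal.rpow_ne_top_of_nonneg hq1 hρ.2.ne
    refine ⟨⟨hmeas, h.trans_lt hfin.lt_top⟩, (ENNReal.toReal_mono hfin h).trans ?_⟩
    rw [← ENNReal.toReal_rpow]
    exact Real.rpow_le_rpow ENNReal.toReal_nonneg hM hq1
  rcases eq_or_ne q 1 with rfl | hq1
  · have : q' = ∞ := by
      have := ENNReal.HolderConjugate.inv_add_inv_eq_one q' 1
      rw [inv_one] at this
      have h2 : q'⁻¹ = 0 := by
        have h3 : q'⁻¹ + 1 = 0 + 1 := by rw [this, zero_add]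
        exact (ENNReal.add_left_inj ENNReal.one_ne_top).1 h3
      exact ENNReal.inv_eq_zero.1 h2
    subst this
    simp only [ENNReal.toReal_one, sub_self, Real.rpow_zero, ENNReal.rpow_zero]
    refine (eLpNorm_le_of_ae_bound (C := 1) (Eventually.of_forall fun t => by simp)).trans ?_
    simp
  · have hlt : 1 < q := lt_of_le_of_ne (ENNReal.HolderConjugate.one_le q q') hq1.symm
    have hpos : 0 < q.toReal - 1 := by
      rw [sub_pos, ← ENNReal.toReal_one]
      exact (ENNReal.toReal_lt_toReal ENNReal.one_ne_top hq').2 hlt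
    rw [eLpNorm_norm_rpow _ hpos]
    have hq't : q' ≠ ∞ := by
      rintro rfl
      have := ENNReal.HolderConjugate.inv_add_inv_eq_one ∞ q
      rw [ENNReal.inv_top, zero_add, ENNReal.inv_eq_one] at this
      exact hq1 this
    have h1 : q'.toReal * (q.toReal - 1) = q.toReal := by
      have h2 := congrArg ENNReal.toReal (ENNReal.HolderConjugate.inv_add_inv_eq_one q' q)
      have hq'0 : q' ≠ 0 := (zero_lt_one.trans_le (ENNReal.HolderConjugate.one_le q' q)).ne'
      have hq0 : q ≠ 0 := (zero_lt_one.trans hlt).ne'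
      rw [ENNReal.toReal_add (ENNReal.inv_ne_top.2 hq'0) (ENNReal.inv_ne_top.2 hq0),
        ENNReal.toReal_inv, ENNReal.toReal_inv, ENNReal.toReal_one] at h2
      have h3 := ENNReal.toReal_pos hq0 hq'
      have h4 := ENNReal.toReal_pos hq'0 hq't
      field_simp at h2
      linarith
    have h2 : q' * ENNReal.ofReal (q.toReal - 1) = q := by
      rw [← ENNReal.ofReal_toReal hq't, ← ENNReal.ofReal_mul ENNReal.toReal_nonneg, h1,
        ENNReal.ofReal_toReal hq']
    rw [h2]

end Integrals

namespace ControlProblem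

variable [Fact (1 ≤ p)] [Fact (1 ≤ q)] [Fact (0 < T)]

theorem norm_fst_le (z : PairSpace d m p q T) : ‖z.fst‖ ≤ ‖z‖ := by
  rw [WithLp.prod_norm_eq_of_L1]
  exact le_add_of_nonneg_right (norm_nonneg _)

theorem norm_snd_le (z : PairSpace d m p q T) : ‖z.snd‖ ≤ ‖z‖ := by
  rw [WithLp.prod_norm_eq_of_L1]
  exact le_add_of_nonneg_left (norm_nonneg _)

theorem ae_norm_snd_le (z : PairSpace d m p ∞ T) : ∀ᵐ t ∂(timeMeasure T), ‖z.snd t‖ ≤ ‖z‖ := by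
  filter_upwards [ae_le_eLpNormEssSup (f := z.snd) (μ := timeMeasure T)] with t ht
  rw [← eLpNorm_exponent_top, ← ofReal_norm] at ht
  exact ((ENNReal.ofReal_le_iff_le_toReal (Lp.memLp z.snd).2.ne).1 ht).trans (norm_snd_le z)

theorem integrable_integrand (P : ControlProblem d m q T) (hθ : ContinuousOnTime T P.θ)
    (hg : q = ∞ ∨ GrowthCondition T P.θ q.toReal 1) (z : PairSpace d m p q T) :
    Integrable (fun t => P.θ (z.fst t) (z.snd t) t) (timeMeasure T) := by
  have hT : 0 < T := Fact.out
  obtain ⟨K, hK0, hK⟩ := SobolevSpace.exists_norm_apply_le d p T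
  have hmeas : AEStronglyMeasurable (fun t => P.θ (z.fst t) (z.snd t) t) (timeMeasure T) := by
    -- Projecting time onto `[0, T]` gives a globally continuous function, whose composition with
    -- measurable maps is measurable.
    have hcont : Continuous fun w : Vec d × Vec m × ℝ =>
        P.θ w.1 w.2.1 (projIcc 0 T hT.le w.2.2) := by
      have h1 : Continuous fun w : Vec d × Vec m × ℝ =>
          (w.1, w.2.1, ((projIcc 0 T hT.le w.2.2 : Icc 0 T) : ℝ)) := by
        have := continuous_projIcc (h := hT.le)
        fun_prop
      exact hθ.comp_continuous h1 fun w => Subtype.mem _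
    have h2 : AEStronglyMeasurable (fun t => (z.fst t, z.snd t, t)) (timeMeasure T) :=
      z.fst.memLp.1.prodMk ((Lp.aestronglyMeasurable z.snd).prodMk aestronglyMeasurable_id)
    refine (hcont.comp_aestronglyMeasurable h2).congr ?_
    filter_upwards [ae_restrict_mem measurableSet_Icc] with t ht
    simp only [projIcc_of_mem hT.le ht]
  have hR : 0 < K * ‖z‖ + 1 := by positivity
  have hxR : ∀ t, ‖z.fst t‖ ≤ K * ‖z‖ + 1 := fun t =>
    (hK z.fst t).trans ((mul_le_mul_of_nonneg_left (norm_fst_le z) hK0).trans (by linarith))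
  by_cases hq : q = ∞
  · subst hq
    obtain ⟨C, -, hC⟩ := hθ.exists_bound (K * ‖z‖ + 1) ‖z‖
    refine Integrable.of_bound hmeas C ?_
    filter_upwards [ae_norm_snd_le z, ae_restrict_mem measurableSet_Icc] with t h1 ht
    exact hC _ _ t ht (hxR t) h1
  · obtain ⟨C, hC0, ω, hω, hω0, hb⟩ := hg.resolve_left hq _ hR
    have h1 : Integrable (fun t => ‖z.snd t‖ ^ q.toReal) (timeMeasure T) :=
      (Lp.memLp z.snd).integrable_norm_rpow (zero_lt_one.trans_le Fact.out).ne' hq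
    refine ((h1.const_mul C).add (memLp_one_iff_integrable.1 hω)).mono' hmeas ?_
    filter_upwards [hb] with t ht
    exact ht _ _ (hxR t)

/-- The cost is Lipschitz continuous on bounded sets. -/
theorem exists_abs_cost_sub_le [ENNReal.HolderConjugate q' q] (P : ControlProblem d m q T)
    (hθ : ContinuousOnTime T P.θ)
    (hdx : ∀ x u, ∀ t ∈ Icc 0 T, DifferentiableAt ℝ (fun y => P.θ y u t) x)
    (hdu : ∀ x u, ∀ t ∈ Icc 0 T, DifferentiableAt ℝ (fun v => P.θ x v t) u)
    (hcx : ContinuousOnTime T (gradX P.θ)) (hcu : ContinuousOnTime T (gradU P.θ))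
    (hg : q = ∞ ∨ (GrowthCondition T P.θ q.toReal 1 ∧
      GrowthCondition T (gradX P.θ) q.toReal 1 ∧
      GrowthCondition T (gradU P.θ) (q.toReal - 1) q')) {r : ℝ} (hr : 0 ≤ r) :
    ∃ L : ℝ, ∀ z w : PairSpace d m p q T, ‖z‖ ≤ r → ‖w‖ ≤ r →
      |P.cost z - P.cost w| ≤ L * dist z w := by
  obtain ⟨K, hK0, hK⟩ := SobolevSpace.exists_norm_apply_le d p T
  have hint : ∀ z : PairSpace d m p q T,
      Integrable (fun t => P.θ (z.fst t) (z.snd t) t) (timeMeasure T) :=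
    P.integrable_integrand hθ (hg.imp_right And.left)
  set R := K * r + 1
  have hR : 0 < R := by positivity
  have hxR : ∀ z : PairSpace d m p q T, ‖z‖ ≤ r → ∀ t, ‖z.fst t‖ ≤ R := fun z hz t =>
    (hK z.fst t).trans
      ((mul_le_mul_of_nonneg_left ((norm_fst_le z).trans hz) hK0).trans (by linarith))
  -- `a`, bounded in `L¹`, pairs with the sup norm of the state increment; `b`, bounded in `L^{q'}`,
  -- pairs with the control increment by Hölder. The bound `N` depends only on `r`.
  suffices H : ∃ N : ℝ, 0 ≤ N ∧ ∀ z w : PairSpace d m p q T, ‖z‖ ≤ r → ‖w‖ ≤ r →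
      ∃ a b : ℝ → ℝ, Integrable a (timeMeasure T) ∧ (∀ᵐ t ∂(timeMeasure T), 0 ≤ a t) ∧
        ∫ t, a t ∂(timeMeasure T) ≤ N ∧ MemLp b q' (timeMeasure T) ∧
        (eLpNorm b q' (timeMeasure T)).toReal ≤ N ∧
        ∀ᵐ t ∂(timeMeasure T), |P.θ (z.fst t) (z.snd t) t - P.θ (w.fst t) (w.snd t) t| ≤
          a t * ‖z.fst t - w.fst t‖ + b t * ‖z.snd t - w.snd t‖ by
    obtain ⟨N, hN, H⟩ := H
    refine ⟨N * K + N, fun z w hz hw => ?_⟩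
    obtain ⟨a, b, ha, ha0, haN, hb, hbN, hab⟩ := H z w hz hw
    have hxsub : ∀ t, ‖z.fst t - w.fst t‖ ≤ K * ‖z.fst - w.fst‖ := fun t => hK (z.fst - w.fst) t
    have husub : (fun t => z.snd t - w.snd t) =ᵐ[timeMeasure T] (z.snd - w.snd : _) :=
      (Lp.coeFn_sub z.snd w.snd).symm
    have hu : MemLp (fun t => z.snd t - w.snd t) q (timeMeasure T) :=
      (Lp.memLp z.snd).sub (Lp.memLp w.snd)
    have hunorm : (eLpNorm (fun t => z.snd t - w.snd t) q (timeMeasure T)).toReal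
        = ‖z.snd - w.snd‖ := by
      rw [eLpNorm_congr_ae husub]; rfl
    obtain ⟨hb1, hb2⟩ := integrable_and_integral_mul_norm_le hb hu
    rw [hunorm] at hb2
    have h1 : |P.cost z - P.cost w| ≤
        (∫ t, a t ∂(timeMeasure T)) * (K * ‖z.fst - w.fst‖) +
          ∫ t, b t * ‖z.snd t - w.snd t‖ ∂(timeMeasure T) := by
      rw [cost, cost, ← integral_sub (hint z) (hint w), ← integral_mul_const,
        ← integral_add (ha.mul_const _) hb1, ← Real.norm_eq_abs]
      refine norm_integral_le_of_norm_le ((ha.mul_const _).add hb1) ?_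
      filter_upwards [hab, ha0] with t h1 h2
      rw [Real.norm_eq_abs]
      exact h1.trans (add_le_add_left (mul_le_mul_of_nonneg_left (hxsub t) h2) _)
    have h2 : (∫ t, a t ∂(timeMeasure T)) * (K * ‖z.fst - w.fst‖) ≤
        N * (K * ‖z.fst - w.fst‖) := mul_le_mul_of_nonneg_right haN (by positivity)
    have h3 : (eLpNorm b q' (timeMeasure T)).toReal * ‖z.snd - w.snd‖ ≤ N * ‖z.snd - w.snd‖ :=
      mul_le_mul_of_nonneg_right hbN (norm_nonneg _)
    have h4 : dist z w = ‖z.fst - w.fst‖ + ‖z.snd - w.snd‖ := by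
      rw [dist_eq_norm, WithLp.prod_norm_eq_of_L1]; rfl
    have h5 : 0 ≤ N * ‖z.fst - w.fst‖ := by positivity
    have h6 : 0 ≤ N * K * ‖z.snd - w.snd‖ := by positivity
    rw [h4]
    nlinarith
  by_cases hq : q = ∞
  · subst hq
    obtain ⟨C₁, hC₁0, hC₁⟩ := hcx.exists_bound R r
    obtain ⟨C₂, hC₂0, hC₂⟩ := hcu.exists_bound R r
    refine ⟨max (∫ _, C₁ ∂(timeMeasure T)) (eLpNorm (fun _ => C₂) q' (timeMeasure T)).toReal,
      le_max_of_le_right ENNReal.toReal_nonneg, fun z w hz hw => ⟨fun _ => C₁, fun _ => C₂,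
      integrable_const _, Eventually.of_forall fun _ => hC₁0, le_max_left _ _, memLp_const _,
      le_max_right _ _, ?_⟩⟩
    filter_upwards [ae_norm_snd_le z, ae_norm_snd_le w, ae_restrict_mem measurableSet_Icc]
      with t h1 h2 ht
    exact abs_sub_le_of_norm_grad_le (fun x u => hdx x u t ht) (fun x u => hdu x u t ht)
      (hxR z hz t) (hxR w hw t) (h1.trans hz) (h2.trans hw)
      (fun ξ hξ => hC₁ ξ _ t ht hξ (h1.trans hz)) (fun η hη => hC₂ _ η t ht (hxR w hw t) hη)
  · obtain ⟨-, hgx, hgu⟩ := hg.resolve_left hq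
    obtain ⟨C₁, hC₁0, ω₁, hω₁, hω₁0, hC₁⟩ := hgx R hR
    obtain ⟨C₂, hC₂0, ω₂, hω₂, hω₂0, hC₂⟩ := hgu R hR
    have hq1 : (1 : ℝ≥0∞) ≤ q := Fact.out
    have hq1' : 0 ≤ q.toReal - 1 := by
      rw [sub_nonneg, ← ENNReal.toReal_one]
      exact ENNReal.toReal_mono hq hq1
    have hq'1 : 1 ≤ q' := ENNReal.HolderConjugate.one_le q' q
    have hω₁i := memLp_one_iff_integrable.1 hω₁
    refine ⟨max (C₁ * r ^ q.toReal + ∫ t, ω₁ t ∂(timeMeasure T))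
      (C₂ * (r + r) ^ (q.toReal - 1) + (eLpNorm ω₂ q' (timeMeasure T)).toReal),
      le_max_of_le_right (by positivity), fun z w hz hw => ?_⟩
    -- The segment between the two controls at time `t` lies in the ball of radius `ρ t`, whence the
    -- norm bound `r + r`. The state gradient is needed only at the control of `z`.
    set ρ : ℝ → ℝ := fun t => ‖z.snd t‖ + ‖w.snd t‖
    have hρ : MemLp ρ q (timeMeasure T) := (Lp.memLp z.snd).norm.add (Lp.memLp w.snd).norm
    have hρr : (eLpNorm ρ q (timeMeasure T)).toReal ≤ r + r := by
      have h1 := ENNReal.toReal_mono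
        (ENNReal.add_ne_top.2 ⟨(Lp.memLp z.snd).norm.2.ne, (Lp.memLp w.snd).norm.2.ne⟩)
        (eLpNorm_add_le (Lp.memLp z.snd).norm.1 (Lp.memLp w.snd).norm.1 hq1)
      rw [ENNReal.toReal_add (Lp.memLp z.snd).norm.2.ne (Lp.memLp w.snd).norm.2.ne,
        eLpNorm_norm, eLpNorm_norm] at h1
      exact h1.trans (add_le_add ((norm_snd_le z).trans hz) ((norm_snd_le w).trans hw))
    have hz1 : Integrable (fun t => ‖z.snd t‖ ^ q.toReal) (timeMeasure T) :=
      (Lp.memLp z.snd).integrable_norm_rpow (zero_lt_one.trans_le hq1).ne' hq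
    obtain ⟨hb1, hb2⟩ := memLp_rpow_sub_one (q' := q') hq hρ hρr
    refine ⟨fun t => C₁ * ‖z.snd t‖ ^ q.toReal + ω₁ t,
      (C₂ • fun t => ‖ρ t‖ ^ (q.toReal - 1)) + ω₂,
      (hz1.const_mul C₁).add hω₁i, ?_, le_max_of_le_left ?_, (hb1.const_smul C₂).add hω₂,
      le_max_of_le_right ?_, ?_⟩
    · filter_upwards [hω₁0] with t ht
      positivity
    · rw [integral_add (hz1.const_mul C₁) hω₁i, integral_const_mul,
        integral_norm_rpow_toReal hq1 hq (Lp.memLp z.snd)]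
      refine add_le_add_left (mul_le_mul_of_nonneg_left (Real.rpow_le_rpow
        ENNReal.toReal_nonneg ((norm_snd_le z).trans hz) ENNReal.toReal_nonneg) hC₁0.le) _
    · have h1 := ENNReal.toReal_mono
        (ENNReal.add_ne_top.2 ⟨(hb1.const_smul C₂).2.ne, hω₂.2.ne⟩)
        (eLpNorm_add_le (hb1.const_smul C₂).1 hω₂.1 hq'1)
      rw [ENNReal.toReal_add (hb1.const_smul C₂).2.ne hω₂.2.ne, eLpNorm_const_smul,
        ENNReal.toReal_mul, toReal_enorm, Real.norm_of_nonneg hC₂0.le] at h1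
      exact h1.trans (add_le_add_left (mul_le_mul_of_nonneg_left hb2 hC₂0.le) _)
    · filter_upwards [hC₁, hC₂, ae_restrict_mem measurableSet_Icc] with t h1 h2 ht
      have hρ0 : 0 ≤ ρ t := add_nonneg (norm_nonneg _) (norm_nonneg _)
      refine abs_sub_le_of_norm_grad_le (ρ := ρ t) (fun x u => hdx x u t ht)
        (fun x u => hdu x u t ht) (hxR z hz t) (hxR w hw t)
        (le_add_of_nonneg_right (norm_nonneg _)) (le_add_of_nonneg_left (norm_nonneg _))
        (fun ξ hξ => h1 ξ _ hξ) (fun η hη => (h2 _ η (hxR w hw t)).trans ?_)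
      simp only [Pi.add_apply, Pi.smul_apply, smul_eq_mul, Real.norm_of_nonneg hρ0]
      exact add_le_add_left (mul_le_mul_of_nonneg_left
        (Real.rpow_le_rpow (norm_nonneg _) hη hq1') hC₂0.le) _

/-! ### Descent of the endpoint penalty -/

theorem continuous_penaltyTerm (P : ControlProblem d m q T) :
    Continuous (P.penaltyTerm : PairSpace d m p q T → ℝ) :=
  (((SobolevSpace.continuous_apply T).comp (WithLp.prod_continuous_ofLp 1 _ _).fst).sub
    continuous_const).norm

/-- Under the negative tangent angle property and the sensitivity property, the distance to the
prescribed final state can be decreased at a uniform rate. -/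
theorem exists_penaltyTerm_descent (P : ControlProblem d m q T)
    (hangle : NegativeTangentAngleProperty (P.reachable p) P.x_T)
    {S : Set (PairSpace d m p q T)} (hS : S ⊆ P.admissible p) (hsens : P.SensitivityProperty S) :
    ∃ δ a : ℝ, 0 < δ ∧ 0 < a ∧ ∀ z ∈ S, P.penaltyTerm z < δ → 0 < P.penaltyTerm z →
      ∃ᶠ w in 𝓝[P.admissible p \ {z}] z, P.penaltyTerm w + a * dist w z ≤ P.penaltyTerm z := by
  obtain ⟨O, hO, β, hβ, hang⟩ := hangle
  obtain ⟨C, hC, hsens⟩ := hsens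
  obtain ⟨δ, hδ, hball⟩ := Metric.mem_nhds_iff.1 hO
  -- With `r = ‖ξ - x_T‖` and a small endpoint step `s`, the distance to `x_T` drops by at least `β
  -- * s / 2`, while property (S) bounds the move in `X` by `C * s`; the quotient is the rate.
  refine ⟨δ, β / (2 * C), hδ, by positivity, fun z hz hzδ hz0 => ?_⟩
  set ξ := z.fst T with hξ
  have hr : P.penaltyTerm z = ‖ξ - P.x_T‖ := rfl
  rw [hr] at hz0 hzδ ⊢
  obtain ⟨ξs, hξs, hlim, hin⟩ := hang ξ ⟨hball (by rwa [Metric.mem_ball, dist_eq_norm]),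
    z, hS hz, rfl⟩ (sub_ne_zero.1 (norm_pos_iff.1 hz0))
  obtain ⟨V, hV, hVz⟩ := hsens z hz
  have hlim0 : Tendsto (fun n => ‖ξs n - ξ‖) atTop (𝓝 0) :=
    tendsto_iff_norm_sub_tendsto_zero.1 hlim
  have hev : ∀ᶠ n in atTop, ξs n ∈ V ∧ ‖ξs n - ξ‖ < ‖ξ - P.x_T‖ * β :=
    (hlim.eventually hV).and (hlim0.eventually_lt_const (by positivity))
  have hdist : ∀ w : PairSpace d m p q T, dist w z = ‖z.snd - w.snd‖ + ‖z.fst - w.fst‖ := by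
    intro w
    rw [dist_comm, dist_eq_norm, WithLp.prod_norm_eq_of_L1, add_comm]; rfl
  rw [Filter.frequently_iff]
  intro W hW
  obtain ⟨η, hη, hWη⟩ := Metric.mem_nhdsWithin_iff.1 hW
  obtain ⟨n, ⟨hnV, hnβ⟩, hnη⟩ :=
    (hev.and (hlim0.eventually_lt_const (show 0 < η / C by positivity))).exists
  obtain ⟨w, hwA, hwT, hwC⟩ := hVz (ξs n) ⟨hnV, (hξs n).1⟩
  rw [hwT, norm_sub_rev (z.fst T) (ξs n), ← hξ, ← hdist] at hwC
  have hs0 : 0 < ‖ξs n - ξ‖ := norm_pos_iff.2 (sub_ne_zero.2 (hξs n).2)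
  have hwz : w ≠ z := by
    rintro rfl
    exact (hξs n).2 hwT.symm
  refine ⟨w, hWη ⟨?_, hwA, hwz⟩, ?_⟩
  · rw [Metric.mem_ball]
    rw [lt_div_iff₀ hC] at hnη
    linarith
  have hinn : inner ℝ (ξ - P.x_T) (ξs n - ξ) ≤ -β * (‖ξ - P.x_T‖ * ‖ξs n - ξ‖) := by
    have := hin n
    rw [real_inner_smul_left, real_inner_smul_right, ← mul_assoc, ← mul_inv,
      inv_mul_le_iff₀ (by positivity)] at this
    linarith
  have hsq : ‖ξs n - P.x_T‖ ^ 2 = ‖ξ - P.x_T‖ ^ 2 + 2 * inner ℝ (ξ - P.x_T) (ξs n - ξ)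
      + ‖ξs n - ξ‖ ^ 2 := by
    rw [← norm_add_sq_real]
    congr 2
    abel
  have hwpen : P.penaltyTerm w = ‖ξs n - P.x_T‖ := by rw [penaltyTerm, hwT]
  rw [hwpen]
  have hrate : β / (2 * C) * dist w z ≤ β / 2 * ‖ξs n - ξ‖ := by
    have h1 : β / (2 * C) * dist w z ≤ β / (2 * C) * (C * ‖ξs n - ξ‖) :=
      mul_le_mul_of_nonneg_left hwC (by positivity)
    have h2 : β / (2 * C) * (C * ‖ξs n - ξ‖) = β / 2 * ‖ξs n - ξ‖ := by field_simp
    linarith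
  have hfin : ‖ξs n - P.x_T‖ + β / 2 * ‖ξs n - ξ‖ ≤ ‖ξ - P.x_T‖ := by
    set r := ‖ξ - P.x_T‖
    set s := ‖ξs n - ξ‖
    set y := ‖ξs n - P.x_T‖
    have hy : 0 ≤ y := norm_nonneg _
    -- The condition `s < r * β` lets half of the cross term `-2 * β * r * s` absorb `s ^ 2`.
    have h1 : y ^ 2 ≤ r ^ 2 - r * β * s := by nlinarith
    have h2 : 0 ≤ β * s := by positivity
    -- Needed for taking square roots below; it follows from `0 ≤ y ^ 2 ≤ r * (r - β * s)`.
    have h3 : 0 ≤ r - β * s := by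
      refine nonneg_of_mul_nonneg_right (a := r) ?_ hz0
      nlinarith [sq_nonneg y]
    have h4 : y ^ 2 ≤ (r - β * s / 2) ^ 2 := by nlinarith [sq_nonneg (β * s)]
    have h5 := (sq_le_sq₀ hy (by linarith)).1 h4
    linarith
  linarith

end ControlProblem

end Cost

end ExactPenalty

end

/-! ### The main theorem -/

theorem mainTheorem9 {d m : ℕ} {p q q' : ℝ≥0∞} [Fact (1 ≤ p)] [Fact (1 ≤ q)]
    (hqq' : 1 / q + 1 / q' = 1) {T : ℝ} [Fact (0 < T)]
    (P : ExactPenalty.ControlProblem d m q T)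
    (hU_nonempty : P.U.Nonempty) (hU_closed : IsClosed P.U)
    -- regularity of the data
    (hθ_cont : ExactPenalty.ContinuousOnTime T P.θ)
    (hθ_diff_x : ∀ x u, ∀ t ∈ Icc 0 T, DifferentiableAt ℝ (fun y => P.θ y u t) x)
    (hθ_diff_u : ∀ x u, ∀ t ∈ Icc 0 T, DifferentiableAt ℝ (fun v => P.θ x v t) u)
    (hθ_gradX_cont : ExactPenalty.ContinuousOnTime T (ExactPenalty.gradX P.θ))
    (hθ_gradU_cont : ExactPenalty.ContinuousOnTime T (ExactPenalty.gradU P.θ))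
    (hf_cont : ExactPenalty.ContinuousOnTime T P.f)
    -- growth conditions
    (h_growth : q = ∞ ∨
      (ExactPenalty.GrowthCondition T P.θ q.toReal 1 ∧
        ExactPenalty.GrowthCondition T (ExactPenalty.gradX P.θ) q.toReal 1 ∧
        ExactPenalty.GrowthCondition T (ExactPenalty.gradU P.θ) (q.toReal - 1) q'))
    -- existence of a globally optimal solution
    (h_opt : ∃ z, ExactPenalty.IsGlobalSolution P.cost (P.feasible p) z)
    -- the reachable set near the prescribed final state
    (h_angle : ExactPenalty.NegativeTangentAngleProperty (P.reachable p) P.x_T)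
    -- the sublevel set
    {lam₀ c δ : ℝ} (h_lam₀ : 0 < lam₀)
    (hc : ExactPenalty.optimalValue P.cost (P.feasible p) < (c : EReal)) (hδ : 0 < δ)
    (h_bdd : Bornology.IsBounded (P.sublevel p lam₀ c ∩ P.nearFeasible p δ))
    (h_sens : P.SensitivityProperty
      (P.sublevel p lam₀ c ∩ (P.nearFeasible p δ \ P.feasible p)))
    (h_below : BddBelow (P.penaltyFn lam₀ '' P.admissible p)) :
    ∃ lamStar : ℝ, 0 ≤ lamStar ∧ ∀ lam : ℝ, lamStar ≤ lam →
      ExactPenalty.IsCompletelyExactOn P.cost (P.penaltyFn lam) (P.feasible p) (P.admissible p)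
        (P.sublevel p lam c) := by
  have : ENNReal.HolderConjugate q' q :=
    ENNReal.holderConjugate_iff.2 (by rw [add_comm, ← one_div, ← one_div, hqq'])
  have hsub : P.sublevel p lam₀ c ∩ (P.nearFeasible p δ \ P.feasible p) ⊆ P.admissible p :=
    fun z hz => hz.1.1
  obtain ⟨δ', a, hδ', ha, hdesc⟩ := P.exists_penaltyTerm_descent h_angle hsub h_sens
  obtain ⟨r, hr0, hr⟩ := h_bdd.exists_pos_norm_le
  have hlip : ∀ ρ : ℝ, 0 ≤ ρ → ∃ L : ℝ, ∀ z w : ExactPenalty.PairSpace d m p q T, ‖z‖ ≤ ρ → ‖w‖ ≤ ρ →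
      |P.cost z - P.cost w| ≤ L * dist z w := fun ρ hρ =>
    P.exists_abs_cost_sub_le (q' := q') hθ_cont hθ_diff_x hθ_diff_u hθ_gradX_cont hθ_gradU_cont
      h_growth hρ
  have hball : ∀ z : ExactPenalty.PairSpace d m p q T, ∀ v ∈ Metric.ball z 1, ‖v‖ ≤ ‖z‖ + 1 := by
    intro z v hv
    rw [Metric.mem_ball, dist_eq_norm] at hv
    have := norm_sub_norm_le v z
    linarith
  have hJ : Continuous (P.cost : ExactPenalty.PairSpace d m p q T → ℝ) := by
    refine continuous_iff_continuousAt.2 fun z => ?_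
    obtain ⟨L, hL⟩ := hlip (‖z‖ + 1) (by positivity)
    have hLip : LipschitzOnWith (Real.toNNReal L) P.cost (Metric.ball z 1) := by
      refine LipschitzOnWith.of_dist_le_mul fun v hv w hw => ?_
      rw [Real.dist_eq]
      exact (hL v w (hball z v hv) (hball z w hw)).trans
        (mul_le_mul_of_nonneg_right (Real.le_coe_toNNReal L) dist_nonneg)
    exact hLip.continuousOn.continuousAt (Metric.ball_mem_nhds z one_pos)
  -- The radius `r + 1` covers the unit balls around all points of the truncated sublevel set, so a
  -- single `L` serves them all.
  obtain ⟨L, hL⟩ := hlip (r + 1) (by positivity)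
  have hfeas : ∀ z, z ∈ P.feasible p ↔ z ∈ P.admissible p ∧ P.penaltyTerm z = 0 := by
    intro z
    rw [ExactPenalty.ControlProblem.penaltyTerm, norm_eq_zero, sub_eq_zero]
    exact and_comm
  -- `δ` secures boundedness and property (S); `δ'` keeps the endpoint in the neighbourhood of the
  -- angle property.
  refine ExactPenalty.exists_isCompletelyExactOn (lam₀ := lam₀) (δ := min δ δ') (L := L) (a := a)
    (P.isClosed_admissible hU_closed hf_cont).isComplete P.continuous_penaltyTerm
    (fun z => norm_nonneg _) hfeas hJ h_lam₀.le (lt_min hδ hδ') ha ?_ ?_ h_below hc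
  · intro z hz hzc hzδ
    have hzr : ‖z‖ ≤ r := hr z ⟨⟨hz, hzc⟩, hz, hzδ.trans_le (min_le_left _ _)⟩
    refine ⟨Metric.ball z 1, Metric.ball_mem_nhds z one_pos, fun v hv w hw => hL v w ?_ ?_⟩
    · exact (hball z v hv).trans (by linarith)
    · exact (hball z w hw).trans (by linarith)
  · intro z hz hzc hzδ hz0
    refine hdesc z ⟨⟨hz, hzc⟩, ⟨hz, hzδ.trans_le (min_le_left _ _)⟩, fun h => ?_⟩
      (hzδ.trans_le (min_le_right _ _)) hz0
    exact hz0.ne' ((hfeas z).1 h).2
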